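/- Let $\mathbf k$ be an algebraically closed field of characteristic $0$. Let $\Gamma$ be a quiver with vertex set $I$ and arrow set $H$, without loops and with finitely many arrows $h_{i,j}$ from $i$ to $j$ for all $i,j\in I$. Put $i\cdot i=2$ and $i\cdot j=-h_{i,j}-h_{j,i}$ for $i\ne j$. Let $\theta$ be an involution of $\Gamma$, that is, a pair of involutions of $I$ and of $H$ such that for each arrow $h$ the arrow $\theta(h)$ goes from $\theta(\text{goal of }h)$ to $\theta(\text{origin of }h)$, and $\theta(h)=h$ iff $\theta$ exchanges the origin and the goal of $h$. Assume that $\theta$ has no fixed vertex. Let $\nu\neq 0$ be an element of $\mathbb N I$ (finitely supported) with $\nu_{\theta(i)}=\nu_i$ for all $i$, write $|\nu|=\sum_i\nu_i=2m$, and let ${}^\theta I^\nu$ be the (finite) set of sequences $\mathbf i=(i_{1-m},\dots,i_m)$ of vertices with $\theta(i_l)=i_{1-l}$ and $\sum_l i_l=\nu$. Let $W_m=\mathfrak S_m\wr\{\pm1\}$ be the group of permutations of $\{1-m,\dots,m\}$ commuting with $l\mapsto 1-l$; it acts on ${}^\theta I^\nu$ by $w(\mathbf i)=\mathbf i\circ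 w^{-1}$. For $1\le k<m$ let $s_k\in W_m$ exchange $k$ and $k+1$ (and $1-k$ and $-k$), let $\varepsilon_1$ exchange $0$ and $1$, and for $m>1$ put $s_0=\varepsilon_1s_1\varepsilon_1$. Let ${}^\circ W_m$ be the subgroup generated by $s_0,\dots,s_{m-1}$ (the Weyl group of type $\mathrm D_m$, with these simple reflections) if $m>1$, and ${}^\circ W_1=\{e\}$. For $m>1$ let ${}^\circ\mathbf R(\Gamma)_\nu$ be the unital associative $\mathbf k$-algebra generated by $1_{\mathbf i}$ ($\mathbf i\in{}^\theta I^\nu$), $\varkappa_l$ ($1\le l\le m$), $\sigma_k$ ($0\le k\le m-1$), with the following relations, where $\varkappa_{1-l}=-\varkappa_l$, and where $Q_{i,j}(u,v)=(-1)^{h_{i,j}}(u-v)^{-i\cdot j}$ if $i\ne j$ and $Q_{i,i}=0$: * $\sum_{\mathbf i}1_{\mathbf i}=1$, $1_{\mathbf i}1_{\mathbf i'}=\delta_{\mathbf i,\mathbf i'}1_{\mathbf i}$, $\sigma_k1_{\mathbf i}=1_{s_k\mathbf i}\sigma_k$, $\varkappa_l1_{\mathbf i}=1_{\mathbf i}\varkappa_l$,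 $\varkappa_l\varkappa_{l'}=\varkappa_{l'}\varkappa_l$; * $\sigma_k^21_{\mathbf i}=Q_{i_k,i_{s_k(k)}}(\varkappa_{s_k(k)},\varkappa_k)1_{\mathbf i}$; * $\sigma_k\sigma_{k'}=\sigma_{k'}\sigma_k$ if $1\le k<k'-1<m-1$ or $0=k<k'\ne2$; * if $s_k(k)\le m-1$, then $(\sigma_{s_k(k)}\sigma_k\sigma_{s_k(k)}-\sigma_k\sigma_{s_k(k)}\sigma_k)1_{\mathbf i}$ equals $$\frac{Q_{i_k,i_{s_k(k)}}(\varkappa_{s_k(k)},\varkappa_k)-Q_{i_k,i_{s_k(k)}}(\varkappa_{s_k(k)},\varkappa_{s_k(k)+1})}{\varkappa_k-\varkappa_{s_k(k)+1}}\,1_{\mathbf i}$$ if $i_k=i_{s_k(k)+1}$, and $0$ otherwise; * $(\sigma_k\varkappa_l-\varkappa_{s_k(l)}\sigma_k)1_{\mathbf i}$ equals, if $i_k=i_{s_k(k)}$, $-1_{\mathbf i}$ for $l=k$, $1_{\mathbf i}$ for $l=s_k(k)$, and $0$ for $l\in\{1-m,\dots,m\}\setminus\{k,\,s_k(k),\,1-k,\,1-s_k(k)\}$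 (the values for $l=1-k$ and $l=1-s_k(k)$ follow from $\varkappa_{1-l}=-\varkappa_l$); it is $0$ for all $l$ if $i_k\ne i_{s_k(k)}$. For $m=1$ let ${}^\circ\mathbf R(\Gamma)_\nu$ be $\bigoplus_{\mathbf i\in{}^\theta I^\nu}\mathbf k[\varkappa_1]1_{\mathbf i}$ (the same presentation, without any $\sigma_k$). The grading is given by $\deg 1_{\mathbf i}=0$, $\deg(\varkappa_l1_{\mathbf i})=2$, $\deg(\sigma_k1_{\mathbf i})=-i_k\cdot i_{s_k(k)}$. Let ${}^\theta\mathbf F_\nu$ be the subalgebra generated by all $1_{\mathbf i}$ and $\varkappa_l1_{\mathbf i}$. For a reduced decomposition $\dot w$: $w=s_{k_1}\cdots s_{k_r}$ of $w\in{}^\circ W_m$ put $\sigma_{\dot w}=\sum_{\mathbf i}1_{\mathbf i}\sigma_{k_1}\cdots\sigma_{k_r}$. **Proposition 1.4.** The rules above make ${}^\circ\mathbf R(\Gamma)_\nu$ a $\mathbb Z$-graded algebra, and ${}^\theta\mathbf F_\nu=\bigoplus_{\mathbf i}{}^\theta\mathbf F_{\mathbf i}$, where ${}^\theta\mathbf F_{\mathbf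 i}$ is the polynomial algebra with unit $1_{\mathbf i}$ in the $m$ variables $\varkappa_l1_{\mathbf i}$, $1\le l\le m$. For every choice of a reduced decomposition $\dot w$ of each $w\in{}^\circ W_m$, the algebra ${}^\circ\mathbf R(\Gamma)_\nu$ is a free left ${}^\theta\mathbf F_\nu$-module with basis $\{\sigma_{\dot w};\,w\in{}^\circ W_m\}$, and a free right ${}^\theta\mathbf F_\nu$-module with the same basis. Its rank, on either side, is $2^{m-1}m!$. For all $\mathbf i\in{}^\theta I^\nu$ and $w\in{}^\circ W_m$ the element $1_{\mathbf i}\sigma_{\dot w}$ is nonzero and homogeneous, and its degree does not depend on the reduced decomposition $\dot w$ of $w$. -/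

import Mathlib

/-! The graded algebra attached to a quiver with involution and a dimension vector, type D. -/

open scoped Classical

noncomputable section

namespace TypeD

universe u v w

/-- A quiver with vertex set `I` and arrow set `H` (origin `src`, goal `tgt`), without loops and
with finitely many arrows between two vertices, together with an involution, given by `θ` on
vertices and `θH` on arrows, which reverses arrows and has no fixed vertex. -/
structure InvQuiver (I : Type u) (H : Type v) where
  src : H → I
  tgt : H → I
  no_loop : ∀ h, src h ≠ tgt h
  finite_arrows : ∀ i j, {h : H | src h = i ∧ tgt h = j}.Finite
  θ : I → I
  θH : H → H
  θ_invol : ∀ i, θ (θ i) = i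
  θH_invol : ∀ h, θH (θH h) = h
  src_θH : ∀ h, src (θH h) = θ (tgt h)
  tgt_θH : ∀ h, tgt (θH h) = θ (src h)
  θ_src_eq_tgt_iff : ∀ h, θ (src h) = tgt h ↔ θH h = h
  θ_ne : ∀ i, θ i ≠ i

namespace InvQuiver

variable {I : Type u} {H : Type v} (Γ : InvQuiver I H)

/-- The number `h_{i,j}` of arrows from `i` to `j`. -/
def numArrows (i j : I) : ℕ := {h : H | Γ.src h = i ∧ Γ.tgt h = j}.ncard

/-- The pairing `i · j`: it is `2` if `i = j`, and `-h_{i,j} - h_{j,i}` otherwise. -/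
def pairing (i j : I) : ℤ :=
  if i = j then 2 else -(Γ.numArrows i j : ℤ) - (Γ.numArrows j i : ℤ)

/-- `Q_{i,j}(u,v) = (-1)^{h_{i,j}} (u-v)^{-i·j}` if `i ≠ j`, and `0` if `i = j`, evaluated at two
elements of a ring. -/
def Q {A : Type w} [Ring A] (i j : I) (a b : A) : A :=
  if i = j then 0
  else (-1) ^ Γ.numArrows i j * (a - b) ^ (Γ.numArrows i j + Γ.numArrows j i)

/-- The polynomial `(Q_{i,j}(u,v) - Q_{i,j}(u,w)) / (v - w)`, evaluated at three elements of a
ring. -/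
def QQuot {A : Type w} [Ring A] (i j : I) (a b c : A) : A :=
  if i = j then 0
  else (-1) ^ Γ.numArrows i j *
    -(∑ p ∈ Finset.range (Γ.numArrows i j + Γ.numArrows j i),
      (a - b) ^ p * (a - c) ^ (Γ.numArrows i j + Γ.numArrows j i - 1 - p))

/-- `QQuot` is the exact quotient. -/
theorem sub_mul_QQuot {A : Type w} [CommRing A] (i j : I) (a b c : A) :
    (b - c) * Γ.QQuot i j a b c = Γ.Q i j a b - Γ.Q i j a c := by
  unfold QQuot Q
  split_ifs with h
  · simp
  · have key := (Commute.all (a - b) (a - c)).mul_geom_sum₂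
      (Γ.numArrows i j + Γ.numArrows j i)
    have h2 : (a - b) - (a - c) = -(b - c) := by ring
    rw [h2] at key
    rw [← mul_sub, ← key]
    ring

end InvQuiver

/-- The set `{1-m, …, m-1, m}`. -/
abbrev Pos (m : ℕ) : Type := {l : ℤ // l ∈ Finset.Icc (1 - (m : ℤ)) m}

/-- The element `l` of `{1-m, …, m}`. -/
abbrev Pos.mk {m : ℕ} (l : ℤ) (h : 1 - (m : ℤ) ≤ l ∧ l ≤ m) : Pos m := ⟨l, Finset.mem_Icc.2 h⟩

/-- The permutation `l ↦ 1 - l` of `{1-m, …, m}`. -/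
def flip (m : ℕ) : Equiv.Perm (Pos m) where
  toFun l := ⟨1 - l.1, by have := Finset.mem_Icc.1 l.2; exact Finset.mem_Icc.2 (by omega)⟩
  invFun l := ⟨1 - l.1, by have := Finset.mem_Icc.1 l.2; exact Finset.mem_Icc.2 (by omega)⟩
  left_inv l := by ext; simp
  right_inv l := by ext; simp

/-- The group `W_m`, the wreath product of the symmetric group on `m` letters and `{1,-1}`, as the
group of all permutations of `{1-m, …, m}` that commute with `l ↦ 1 - l` (its action on this set
is faithful with this image). -/
def W (m : ℕ) : Subgroup (Equiv.Perm (Pos m)) := Subgroup.centralizer {flip m}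

theorem flip_ne {m : ℕ} (a : Pos m) : flip m a ≠ a := by
  intro h
  have := congrArg Subtype.val h
  simp only [flip, Equiv.coe_fn_mk] at this
  omega

theorem flip_flip {m : ℕ} (a : Pos m) : flip m (flip m a) = a := by
  ext; simp [flip]

/-- `ε_a`, which exchanges `a` and `1 - a`. -/
def eps {m : ℕ} (a : Pos m) : W m :=
  ⟨Equiv.swap a (flip m a), by
    rw [W, Subgroup.mem_centralizer_singleton_iff]
    ext1 l
    simp only [Equiv.Perm.mul_apply]
    have h1 := (flip m).injective.swap_apply a (flip m a) l
    rw [flip_flip, Equiv.swap_comm] at h1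
    exact h1⟩

/-- The element of `W_m` which exchanges `a` and `b`, and `1 - a` and `1 - b`
(for `b ≠ 1 - a`). -/
def dswap {m : ℕ} (a b : Pos m) (hab : b ≠ flip m a) : W m :=
  ⟨Equiv.swap a b * Equiv.swap (flip m a) (flip m b), by
    rw [W, Subgroup.mem_centralizer_singleton_iff]
    ext1 l
    have h1 := (flip m).injective.swap_apply a b (Equiv.swap (flip m a) (flip m b) l)
    have h2 := (flip m).injective.swap_apply (flip m a) (flip m b) l
    rw [flip_flip, flip_flip] at h2
    have hd : (Equiv.swap (flip m a) (flip m b)).Disjoint (Equiv.swap a b) ∨ a = b := by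
      by_cases h : a = b
      · exact Or.inr h
      · left
        have hba : flip m b ≠ a := fun h' => hab (by rw [← h', flip_flip])
        rw [Equiv.Perm.disjoint_iff_disjoint_support,
          Equiv.Perm.support_swap (fun h' => h ((flip m).injective h')),
          Equiv.Perm.support_swap h]
        simp only [Finset.disjoint_left, Finset.mem_insert, Finset.mem_singleton]
        rintro x (rfl | rfl) (hx | hx)
        · exact flip_ne _ hx
        · exact hab hx.symm
        · exact hba hx
        · exact flip_ne _ hx
    rcases hd with hd | rfl
    · have h3 := congrArg (fun p : Equiv.Perm (Pos m) => p (flip m l)) hd.commute.eq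
      simp only [Equiv.Perm.mul_apply] at h3 ⊢
      rw [← h1, ← h2, h3]
    · simp⟩

/-- The set `{0, 1, …, m-1}` of indices of the simple reflections of type `D_m`, for `m > 1`. It is
empty for `m ≤ 1`. -/
abbrev Idx (m : ℕ) : Type := {k : ℕ // k < m ∧ 1 < m}

/-- The index `k`, as an element of `{1-m, …, m}`. -/
def Idx.pos {m : ℕ} (k : Idx m) : Pos m := Pos.mk (k.1 : ℤ) (by have := k.2; omega)

/-- The element `k + 1` of `{1-m, …, m}`. -/
def Idx.succ {m : ℕ} (k : Idx m) : Pos m := Pos.mk ((k.1 : ℤ) + 1) (by have := k.2; omega)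

theorem Idx.succ_ne {m : ℕ} (k : Idx m) (hk : k.1 ≠ 0) : k.succ ≠ flip m k.pos := by
  intro h
  have := congrArg Subtype.val h
  simp only [flip, Idx.succ, Idx.pos, Pos.mk, Equiv.coe_fn_mk] at this
  omega

/-- The simple reflections: for `k ≥ 1`, `s_k` exchanges `k` and `k+1` (hence also `1-k` and `-k`);
and `s_0 = ε_1 s_1 ε_1`. -/
def s {m : ℕ} (k : Idx m) : W m :=
  if hk : k.1 = 0 then
    let k₁ : Idx m := ⟨1, k.2.2, k.2.2⟩
    eps k₁.pos * dswap k₁.pos k₁.succ (k₁.succ_ne one_ne_zero) * eps k₁.pos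
  else dswap k.pos k.succ (k.succ_ne hk)

/-- The subgroup of `W_m` generated by the `s_k`: the Weyl group of type `D_m` (trivial if
`m = 1`). -/
def WD (m : ℕ) : Subgroup (W m) := Subgroup.closure (Set.range s)

/-- `s_k(k)`; it is `k + 1` if `k ≥ 1`, and `2` if `k = 0`. -/
def nxt {m : ℕ} (k : Idx m) : Pos m := (s k).1 k.pos

/-- `s_{k_1} ⋯ s_{k_r}` is a reduced decomposition of `x`. -/
def IsReduced {m : ℕ} (l : List (Idx m)) (x : W m) : Prop :=
  (l.map s).prod = x ∧ ∀ l' : List (Idx m), (l'.map s).prod = x → l.length ≤ l'.length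

section Algebra

variable {I : Type u} {H : Type v} (Γ : InvQuiver I H) (ν : I →₀ ℕ) (m : ℕ)

/-- The set of sequences `(i_{1-m}, …, i_m)` of vertices with `θ(i_l) = i_{1-l}` and
`∑_l i_l = ν`. -/
def Seq : Type u :=
  {i : Pos m → I // (∀ l, Γ.θ (i l) = i (flip m l)) ∧ ∑ l, Finsupp.single (i l) 1 = ν}

instance : CoeFun (Seq Γ ν m) (fun _ => Pos m → I) := ⟨Subtype.val⟩

instance : Finite (Seq Γ ν m) := by
  have hmem : ∀ (i : Seq Γ ν m) (l : Pos m), i l ∈ ν.support := by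
    intro i l
    have h0 := DFunLike.congr_fun i.2.2 (i l)
    rw [Finsupp.finsetSum_apply] at h0
    rw [Finsupp.mem_support_iff, ← h0]
    have h := Finset.single_le_sum (f := fun l' => Finsupp.single (i l') 1 (i l))
      (fun _ _ => Nat.zero_le _) (Finset.mem_univ l)
    simp only [Finsupp.single_eq_same] at h
    exact Nat.one_le_iff_ne_zero.1 h
  exact Finite.of_injective
    (fun i : Seq Γ ν m => fun l : Pos m => (⟨i l, hmem i l⟩ : ν.support))
    (fun i j hij => Subtype.ext (funext fun l => congrArg Subtype.val (congrFun hij l)))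

instance : Fintype (Seq Γ ν m) := Fintype.ofFinite _

variable {Γ ν m}

/-- The action of `W_m` on sequences, `x(i) = i ∘ x⁻¹`. -/
def Seq.act (x : W m) (i : Seq Γ ν m) : Seq Γ ν m :=
  ⟨fun l => i ((x⁻¹ : W m).1 l), by
    refine ⟨fun l => ?_, ?_⟩
    · rw [i.2.1]
      have h := (Subgroup.mem_centralizer_singleton_iff.1 (x⁻¹ : W m).2)
      exact congrArg i.1 (congrArg (fun p : Equiv.Perm (Pos m) => p l) h).symm
    · exact (Equiv.sum_comp (x⁻¹ : W m).1 (fun l => Finsupp.single (i l) 1)).trans i.2.2⟩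

variable (Γ ν m)

/-- The generators `1_i`, `ϰ_l` and `σ_k`. For convenience there is a `ϰ_l` for all `l` in
`{1-m, …, m}`; the relation `ϰ_{1-l} = -ϰ_l` is imposed. -/
inductive Gen : Type u
  | idem (i : Seq Γ ν m) : Gen
  | kap (l : Pos m) : Gen
  | sig (k : Idx m) : Gen

variable (K : Type w) [Field K]

/-- The free algebra on the generators. -/
abbrev Free := FreeAlgebra K (Gen Γ ν m)

variable {Γ ν m}

/-- The free generator `1_i`. -/
def fidem (i : Seq Γ ν m) : Free Γ ν m K := FreeAlgebra.ι K (Gen.idem i)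

variable (Γ ν)

/-- The free generator `ϰ_l`. -/
def fkap (l : Pos m) : Free Γ ν m K := FreeAlgebra.ι K (Gen.kap l)

/-- The free generator `σ_k`. -/
def fsig (k : Idx m) : Free Γ ν m K := FreeAlgebra.ι K (Gen.sig k)

variable {Γ ν}

/-- The scalar `c` such that `(σ_k ϰ_l - ϰ_{s_k(l)} σ_k) 1_i = c 1_i`. If `i_k = i_{s_k(k)}` it is
`-1` for `l = k` and `1` for `l = s_k(k)`, hence, as `ϰ_{1-l} = -ϰ_l`, it is `1` for `l = 1 - k` and
`-1` for `l = 1 - s_k(k)`. It is `0` in all other cases. -/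
def slideConst (k : Idx m) (l : Pos m) (i : Seq Γ ν m) : K :=
  if i k.pos = i (nxt k) then
    if l = k.pos ∨ l = flip m (nxt k) then -1
    else if l = nxt k ∨ l = flip m k.pos then 1
    else 0
  else 0

variable (Γ ν m)

/-- The defining relations. -/
inductive Rel : Free Γ ν m K → Free Γ ν m K → Prop
  | sum_idem : Rel (∑ i, fidem K i) 1
  | idem_self (i : Seq Γ ν m) : Rel (fidem K i * fidem K i) (fidem K i)
  | idem_ne (i j : Seq Γ ν m) (hij : i ≠ j) : Rel (fidem K i * fidem K j) 0
  | sig_idem (k : Idx m) (i : Seq Γ ν m) :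
      Rel (fsig Γ ν K k * fidem K i) (fidem K (i.act (s k)) * fsig Γ ν K k)
  | kap_idem (l : Pos m) (i : Seq Γ ν m) :
      Rel (fkap Γ ν K l * fidem K i) (fidem K i * fkap Γ ν K l)
  | kap_flip (l : Pos m) : Rel (fkap Γ ν K (flip m l)) (-fkap Γ ν K l)
  | kap_comm (l l' : Pos m) : Rel (fkap Γ ν K l * fkap Γ ν K l') (fkap Γ ν K l' * fkap Γ ν K l)
  | sig_sq (k : Idx m) (i : Seq Γ ν m) :
      Rel (fsig Γ ν K k * fsig Γ ν K k * fidem K i)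
        (Γ.Q (i k.pos) (i (nxt k)) (fkap Γ ν K (nxt k)) (fkap Γ ν K k.pos) * fidem K i)
  | sig_comm (k k' : Idx m)
      (hk : (1 ≤ k.1 ∧ k.1 + 1 < k'.1) ∨ (k.1 = 0 ∧ 0 < k'.1 ∧ k'.1 ≠ 2)) :
      Rel (fsig Γ ν K k * fsig Γ ν K k') (fsig Γ ν K k' * fsig Γ ν K k)
  /-- The braid relation for `k` and `k' = s_k(k)`, where `k'` is an index in `{1, …, m-1}`. -/
  | braid (k k' : Idx m) (hk : k'.pos = nxt k) (i : Seq Γ ν m) :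
      Rel ((fsig Γ ν K k' * fsig Γ ν K k * fsig Γ ν K k'
          - fsig Γ ν K k * fsig Γ ν K k' * fsig Γ ν K k) * fidem K i)
        (if i k.pos = i k'.succ then
          Γ.QQuot (i k.pos) (i (nxt k)) (fkap Γ ν K (nxt k)) (fkap Γ ν K k.pos)
            (fkap Γ ν K k'.succ) * fidem K i
        else 0)
  | slide (k : Idx m) (l : Pos m) (i : Seq Γ ν m) :
      Rel ((fsig Γ ν K k * fkap Γ ν K l - fkap Γ ν K ((s k).1 l) * fsig Γ ν K k) * fidem K i)
        (slideConst K k l i • fidem K i)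

/-- The algebra presented by the generators `1_i`, `ϰ_l`, `σ_k` and the relations above. For
`m = 1` there are no `σ_k`, and it is the direct sum of the two algebras `K[ϰ_1] 1_i`. -/
abbrev R := RingQuot (Rel Γ ν m K)

variable {Γ ν m}

/-- The element `1_i`. -/
def idem (i : Seq Γ ν m) : R Γ ν m K := RingQuot.mkAlgHom K (Rel Γ ν m K) (fidem K i)

variable (Γ ν)

/-- The element `ϰ_l`. -/
def kap (l : Pos m) : R Γ ν m K := RingQuot.mkAlgHom K (Rel Γ ν m K) (fkap Γ ν K l)

/-- The element `σ_k`. -/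
def sig (k : Idx m) : R Γ ν m K := RingQuot.mkAlgHom K (Rel Γ ν m K) (fsig Γ ν K k)

/-- The element `∑_i 1_i σ_{k_1} ⋯ σ_{k_r}` attached to a word `k_1, …, k_r`. -/
def sigWord (l : List (Idx m)) : R Γ ν m K := ∑ i, idem K i * (l.map (sig Γ ν K)).prod

variable (m)

/-- The homogeneous generators `1_i`, `ϰ_l 1_i` and `σ_k 1_i`. -/
inductive HGen : Type u
  | idem (i : Seq Γ ν m) : HGen
  | kap (l : Pos m) (i : Seq Γ ν m) : HGen
  | sig (k : Idx m) (i : Seq Γ ν m) : HGen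

variable {Γ ν m}

/-- The element of the algebra given by a homogeneous generator. -/
def HGen.elem : HGen Γ ν m → R Γ ν m K
  | .idem i => TypeD.idem K i
  | .kap l i => TypeD.kap Γ ν K l * TypeD.idem K i
  | .sig k i => TypeD.sig Γ ν K k * TypeD.idem K i

/-- `deg 1_i = 0`, `deg (ϰ_l 1_i) = 2` and `deg (σ_k 1_i) = - i_k · i_{s_k(k)}`. -/
def HGen.deg : HGen Γ ν m → ℤ
  | .idem _ => 0
  | .kap _ _ => 2
  | .sig k i => -Γ.pairing (i k.pos) (i (nxt k))

variable (Γ ν m)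

/-- The homogeneous component of degree `d`: the span of the products of homogeneous generators of
total degree `d`. -/
def grading (d : ℤ) : Submodule K (R Γ ν m K) :=
  Submodule.span K
    {x | ∃ l : List (HGen Γ ν m), (l.map HGen.deg).sum = d ∧ x = (l.map (HGen.elem K)).prod}

/-- The subalgebra generated by the elements `1_i` and `ϰ_l 1_i`. -/
def F : Subalgebra K (R Γ ν m K) :=
  Algebra.adjoin K
    {x | ∃ i : Seq Γ ν m, x = idem K i ∨ ∃ l : Pos m, x = kap Γ ν K l * idem K i}

end Algebra

/-- The element `l + 1` of `{1-m, …, m}`, for `l` in `{0, …, m-1}`. -/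
def Pos.ofFin {m : ℕ} (l : Fin m) : Pos m := Pos.mk ((l.1 : ℤ) + 1) (by omega)

end TypeD

end

noncomputable section

namespace TypeD

universe u v w

/-! ### Combinatorics of the Weyl group of type D: roots, exchange condition, reduced words and
braid moves -/

section WeylGroup

variable {m : ℕ}

/-! The argument is the PBW theorem for algebras of Khovanov–Lauda–Rouquier type: spanning by
straightening words, independence by a faithful representation.

Spanning. The slide relation moves every `ϰ_l` to the left of `σ_k` at the cost of an element of `F`
(`sig_mul_F`), so the words in the `σ_k` span. Modulo shorter words, a braid move does not change a
word, and `σ_k ^ 2` lies in `F`. The exchange condition and Matsumoto's theorem (`exchange`,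
`BraidEq.of_reduced`) therefore reduce every word to the chosen reduced words (`span_dot_eq_top`).

Independence. The algebra acts on functions from sequences to the field of rational functions in
`x_1, …, x_m`: `ϰ_l` multiplies by `x_l`, and `σ_k` is a divided difference where the two vertices
agree and a power of a linear form times the reflection where they differ (`Frame.satisfies`). A
word `ẇ` then becomes a combination of group elements, with nonzero coefficient at `w` when `ẇ` is
reduced and all other terms given by shorter words. Independence of the field automorphisms
(Dedekind) turns this triangularity into linear independence (`linearIndependent_dot`) and into `1_i
σ_ẇ ≠ 0`. The same action shows that `F` is a sum of polynomial algebras.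

The right module follows from the left one through the anti-involution that fixes all generators; it
reverses words, hence inverts group elements. The rank is the order of the group: `W m` is the
centralizer of a fixed-point-free involution, and for `m > 1` the subgroup `WD m` is the kernel of
the sign inside it.

Grading. The relations are homogeneous, so sending each homogeneous generator `g` to `g t^(deg g)`
defines a homomorphism to Laurent polynomials over the algebra; reading off coefficients makes the
sum of the components direct (`isInternal_grading`). The degree of a word is invariant under braid
moves, so Matsumoto's theorem makes it depend on `w` and `i` only. -/

theorem Pos.bounds (l : Pos m) : 1 - (m : ℤ) ≤ l.1 ∧ l.1 ≤ m := Finset.mem_Icc.1 l.2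

@[simp] theorem flip_val (l : Pos m) : (flip m l).1 = 1 - l.1 := rfl

@[simp] theorem Idx.pos_val (k : Idx m) : k.pos.1 = k.1 := rfl

@[simp] theorem Idx.succ_val (k : Idx m) : k.succ.1 = k.1 + 1 := rfl

theorem W.apply_flip (w : W m) (l : Pos m) : w.1 (flip m l) = flip m (w.1 l) :=
  congrArg (fun p : Equiv.Perm (Pos m) => p l) (Subgroup.mem_centralizer_singleton_iff.1 w.2)

theorem W.mul_apply (w w' : W m) (l : Pos m) : (w * w').1 l = w.1 (w'.1 l) := rfl

theorem W.one_apply (l : Pos m) : (1 : W m).1 l = l := rfl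

theorem W.ext {w w' : W m} (h : ∀ l, w.1 l = w'.1 l) : w = w' :=
  Subtype.ext (Equiv.ext h)

theorem eps_val (a l : Pos m) :
    ((eps a).1 l).1 = if l.1 = a.1 then 1 - a.1 else if l.1 = 1 - a.1 then a.1 else l.1 := by
  simp only [eps, Equiv.swap_apply_def, Subtype.ext_iff, flip_val]
  split_ifs <;> simp_all

theorem dswap_val (a b l : Pos m) (hab : b ≠ flip m a) (h : a ≠ b) :
    ((dswap a b hab).1 l).1 = if l.1 = a.1 then b.1 else if l.1 = b.1 then a.1 else
      if l.1 = 1 - a.1 then 1 - b.1 else if l.1 = 1 - b.1 then 1 - a.1 else l.1 := by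
  have hab' : b.1 ≠ 1 - a.1 := fun h' => hab (Subtype.ext h')
  have h' : a.1 ≠ b.1 := fun h' => h (Subtype.ext h')
  simp only [dswap, Equiv.Perm.mul_apply, Equiv.swap_apply_def, Subtype.ext_iff, flip_val,
    apply_ite Subtype.val]
  split_ifs <;> omega

/-- In integer coordinates the later identities between positions become case distinctions for
`omega`; in particular `s_0` is the double exchange of 0 with 2 and of 1 with -1. -/
theorem s_val (k : Idx m) (l : Pos m) :
    ((s k).1 l).1 = if k.1 = 0 then
        if l.1 = 0 then 2 else if l.1 = 2 then 0 else if l.1 = 1 then -1 else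
          if l.1 = -1 then 1 else l.1
      else if l.1 = k.1 then (k.1 : ℤ) + 1 else if l.1 = k.1 + 1 then (k.1 : ℤ) else
        if l.1 = 1 - k.1 then -(k.1 : ℤ) else if l.1 = -(k.1 : ℤ) then 1 - (k.1 : ℤ) else l.1 := by
  by_cases hk : k.1 = 0
  · rw [s, dif_pos hk, if_pos hk]
    simp only [W.mul_apply]
    rw [eps_val, dswap_val _ _ _ _ (fun h => by have := congrArg Subtype.val h; simp at this),
      eps_val]
    simp only [Idx.pos_val, Idx.succ_val, Nat.cast_one]
    split_ifs <;> omega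
  · rw [s, dif_neg hk, if_neg hk,
      dswap_val _ _ _ _ (fun h => by have := congrArg Subtype.val h; simp at this)]
    simp only [Idx.pos_val, Idx.succ_val]
    split_ifs <;> omega

theorem s_val_of_eq {k : Idx m} (hk : k.1 = 0) (l : Pos m) :
    ((s k).1 l).1 = if l.1 = 0 then 2 else if l.1 = 2 then 0 else if l.1 = 1 then -1 else
      if l.1 = -1 then 1 else l.1 := by
  rw [s_val, if_pos hk]

theorem s_val_of_ne {k : Idx m} (hk : k.1 ≠ 0) (l : Pos m) :
    ((s k).1 l).1 = if l.1 = k.1 then (k.1 : ℤ) + 1 else if l.1 = k.1 + 1 then (k.1 : ℤ) else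
      if l.1 = 1 - k.1 then -(k.1 : ℤ) else if l.1 = -(k.1 : ℤ) then 1 - (k.1 : ℤ) else l.1 := by
  rw [s_val, if_neg hk]

theorem nxt_val (k : Idx m) : (nxt k).1 = if k.1 = 0 then 2 else (k.1 : ℤ) + 1 := by
  rw [nxt, s_val]
  simp only [Idx.pos_val]
  split_ifs <;> omega

theorem pos_ne_nxt (k : Idx m) : k.pos ≠ nxt k := fun h => by
  have := congrArg Subtype.val h
  rw [nxt_val, Idx.pos_val] at this
  split_ifs at this <;> omega

theorem pos_ne_flip_nxt (k : Idx m) : k.pos ≠ flip m (nxt k) := fun h => by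
  have := congrArg Subtype.val h
  rw [flip_val, nxt_val, Idx.pos_val] at this
  split_ifs at this <;> omega

theorem flip_eq_iff {a b : Pos m} : flip m a = b ↔ a = flip m b := by
  constructor <;> rintro rfl <;> simp [flip_flip]

theorem s_apply (k : Idx m) (l : Pos m) :
    (s k).1 l = if l = k.pos then nxt k else if l = nxt k then k.pos else
      if l = flip m k.pos then flip m (nxt k) else if l = flip m (nxt k) then flip m k.pos
      else l := by
  apply Subtype.ext
  by_cases hk : k.1 = 0
  · rw [s_val_of_eq hk]
    simp only [apply_ite Subtype.val, Subtype.ext_iff, flip_val, nxt_val, if_pos hk, Idx.pos_val]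
    split_ifs <;> omega
  · rw [s_val_of_ne hk]
    simp only [apply_ite Subtype.val, Subtype.ext_iff, flip_val, nxt_val, if_neg hk, Idx.pos_val]
    split_ifs <;> omega

@[simp] theorem s_pos (k : Idx m) : (s k).1 k.pos = nxt k := rfl

@[simp] theorem s_nxt (k : Idx m) : (s k).1 (nxt k) = k.pos := by
  rw [s_apply, if_neg (pos_ne_nxt k).symm, if_pos rfl]

theorem s_apply_of_ne (k : Idx m) {l : Pos m} (h1 : l ≠ k.pos) (h2 : l ≠ nxt k)
    (h3 : l ≠ flip m k.pos) (h4 : l ≠ flip m (nxt k)) : (s k).1 l = l := by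
  rw [s_apply, if_neg h1, if_neg h2, if_neg h3, if_neg h4]

theorem s_s_apply (k : Idx m) (l : Pos m) : (s k).1 ((s k).1 l) = l := by
  by_cases h1 : l = k.pos
  · rw [h1, s_pos, s_nxt]
  by_cases h2 : l = nxt k
  · rw [h2, s_nxt, s_pos]
  by_cases h3 : l = flip m k.pos
  · rw [h3, W.apply_flip, W.apply_flip, s_pos, s_nxt]
  by_cases h4 : l = flip m (nxt k)
  · rw [h4, W.apply_flip, W.apply_flip, s_nxt, s_pos]
  have := s_apply_of_ne k h1 h2 h3 h4
  rw [this, this]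

@[simp] theorem s_mul_s (k : Idx m) : s k * s k = 1 := W.ext fun l => s_s_apply k l

@[simp] theorem s_inv (k : Idx m) : (s k)⁻¹ = s k := inv_eq_of_mul_eq_one_right (s_mul_s k)

@[simp] theorem s_mul_s_mul (k : Idx m) (w : W m) : s k * (s k * w) = w := by
  rw [← mul_assoc, s_mul_s, one_mul]

/-- Two pairs of positions define the same root. -/
def SameRoot (p q a b : Pos m) : Prop := (p = a ∧ q = b) ∨ (p = flip m b ∧ q = flip m a)

/-- This is the rule `w s_α w⁻¹ = s_{wα}`. A pair `(p, q)` stands for the root `x_p - x_q`, and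
since `x_{1-l} = -x_l` the pair `(1-q, 1-p)` stands for the same root; hence the two cases. -/
theorem mul_s_of_sameRoot {w : W m} {k k' : Idx m}
    (h : SameRoot (w.1 k.pos) (w.1 (nxt k)) k'.pos (nxt k')) : w * s k = s k' * w := by
  have hinj : ∀ {x y : Pos m}, w.1 x = w.1 y ↔ x = y := w.1.injective.eq_iff
  apply W.ext
  intro l
  rw [W.mul_apply, W.mul_apply]
  have hf := W.apply_flip w
  rcases h with ⟨h1, h2⟩ | ⟨h1, h2⟩
  · rw [s_apply, s_apply k', ← h1, ← h2, ← hf, ← hf]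
    simp only [hinj]
    split_ifs <;> rfl
  · rw [s_apply, s_apply k']
    have h1' : nxt k' = w.1 (flip m k.pos) := by rw [hf, h1, flip_flip]
    have h2' : k'.pos = w.1 (flip m (nxt k)) := by rw [hf, h2, flip_flip]
    rw [h1', h2', ← hf, ← hf]
    simp only [hinj, flip_flip]
    have e1 := pos_ne_nxt k
    have e2 := pos_ne_flip_nxt k
    have e3 := flip_ne (nxt k)
    have e4 := flip_ne k.pos
    split_ifs <;> simp_all [flip_eq_iff]

/-- A simple reflection changes the sign of no positive root but its own. Positive roots are the
pairs `p < q` with `p ≠ 1 - q`; the excluded pairs would be the roots `2 x_p`, absent in type D. -/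
theorem sameRoot_of_s_lt {k : Idx m} {p q : Pos m} (hpq : p.1 < q.1) (hf : p ≠ flip m q)
    (h : ((s k).1 q).1 < ((s k).1 p).1) : SameRoot p q k.pos (nxt k) := by
  have hf' : p.1 ≠ 1 - q.1 := fun h' => hf (Subtype.ext h')
  simp only [SameRoot, Subtype.ext_iff, flip_val, nxt_val, Idx.pos_val]
  by_cases hk : k.1 = 0
  · rw [s_val_of_eq hk, s_val_of_eq hk] at h
    rw [if_pos hk]
    split_ifs at h <;> omega
  · rw [s_val_of_ne hk, s_val_of_ne hk] at h
    rw [if_neg hk]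
    split_ifs at h <;> omega

/-- The element of `W_m` given by a word. -/
abbrev wprod (l : List (Idx m)) : W m := (l.map s).prod

theorem wprod_cons (k : Idx m) (l : List (Idx m)) : wprod (k :: l) = s k * wprod l := by
  simp [wprod]

theorem wprod_reverse (l : List (Idx m)) : wprod l.reverse = (wprod l)⁻¹ := by
  induction l with
  | nil => simp [wprod]
  | cons k l ih => simp [wprod] at ih ⊢; rw [ih]

/-- `x⁻¹` sends the simple root attached to `k` to a negative root. -/
def Descent (x : W m) (k : Idx m) : Prop := ((x⁻¹).1 (nxt k)).1 < ((x⁻¹).1 k.pos).1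

theorem descent_s_mul {x : W m} {k : Idx m} : Descent (s k * x) k ↔ ¬ Descent x k := by
  have h : (x⁻¹).1 (nxt k) ≠ (x⁻¹).1 k.pos := fun h => pos_ne_nxt k ((x⁻¹).1.injective h).symm
  have h' : ((x⁻¹).1 (nxt k)).1 ≠ ((x⁻¹).1 k.pos).1 := fun h' => h (Subtype.ext h')
  simp only [Descent, mul_inv_rev, s_inv, W.mul_apply, s_pos, s_nxt]
  omega

/-- The letters act on the root one after the other, and the first one that makes it negative must
be the reflection in the root reached at that moment. -/
theorem exists_split_of_neg (l : List (Idx m)) (p q : Pos m) (hpq : p.1 < q.1)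
    (hf : p ≠ flip m q) (h : (((wprod l)⁻¹).1 q).1 < (((wprod l)⁻¹).1 p).1) :
    ∃ l₁ j l₂, l = l₁ ++ j :: l₂ ∧
      SameRoot (((wprod l₁)⁻¹).1 p) (((wprod l₁)⁻¹).1 q) j.pos (nxt j) := by
  induction l generalizing p q with
  | nil => exact absurd h (by simpa [wprod, W.one_apply] using hpq.le)
  | cons k l ih =>
    rw [wprod_cons, mul_inv_rev, s_inv, W.mul_apply, W.mul_apply] at h
    by_cases hs : ((s k).1 q).1 < ((s k).1 p).1
    · exact ⟨[], k, l, rfl, by simpa [wprod, W.one_apply] using sameRoot_of_s_lt hpq hf hs⟩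
    · have hne : ((s k).1 q).1 ≠ ((s k).1 p).1 := fun h' => by
        have := (s k).1.injective (Subtype.ext h')
        rw [this] at hpq
        exact lt_irrefl _ hpq
      obtain ⟨l₁, j, l₂, rfl, hr⟩ := ih ((s k).1 p) ((s k).1 q) (by omega)
        (fun h' => hf ((s k).1.injective (by rw [h', W.apply_flip]))) h
      exact ⟨k :: l₁, j, l₂, rfl, by
        simpa only [wprod_cons, mul_inv_rev, s_inv, W.mul_apply] using hr⟩

/-- The exchange condition. The inverse of the prefix `l₁` carries the simple root of `k` to that of
`j`, so conjugation by the prefix turns `s j` into `s k`. -/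
theorem exchange {l : List (Idx m)} {k : Idx m} (h : Descent (wprod l) k) :
    ∃ l₁ j l₂, l = l₁ ++ j :: l₂ ∧ s k * wprod l₁ = wprod l₁ * s j := by
  obtain ⟨l₁, j, l₂, rfl, hr⟩ := exists_split_of_neg l k.pos (nxt k)
    (by rw [nxt_val, Idx.pos_val]; split_ifs <;> omega) (pos_ne_flip_nxt k) h
  refine ⟨l₁, j, l₂, rfl, ?_⟩
  have h := mul_s_of_sameRoot hr
  calc s k * wprod l₁ = wprod l₁ * ((wprod l₁)⁻¹ * s k) * wprod l₁ := by group
    _ = wprod l₁ * s j := by rw [h]; group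

theorem exchange_length {l : List (Idx m)} {k : Idx m} (h : Descent (wprod l) k) :
    ∃ l', l'.length + 1 = l.length ∧ wprod l' = s k * wprod l := by
  obtain ⟨l₁, j, l₂, rfl, he⟩ := exchange h
  refine ⟨l₁ ++ l₂, by simp; omega, ?_⟩
  simp only [wprod, List.map_append, List.prod_append, List.map_cons, List.prod_cons]
  rw [← mul_assoc, ← wprod, he]
  simp [mul_assoc]

/-- Reduced words. -/
abbrev Reduced (l : List (Idx m)) : Prop := IsReduced l (wprod l)

theorem IsReduced.reduced {l : List (Idx m)} {x : W m} (h : IsReduced l x) : Reduced l := by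
  obtain ⟨rfl, h⟩ := h
  exact ⟨rfl, h⟩

theorem Reduced.le {l l' : List (Idx m)} (h : Reduced l) (h' : wprod l' = wprod l) :
    l.length ≤ l'.length := h.2 l' h'

theorem Reduced.of_length_le {l l' : List (Idx m)} (h : Reduced l) (h' : wprod l' = wprod l)
    (hl : l'.length ≤ l.length) : Reduced l' :=
  ⟨rfl, fun _ h'' => hl.trans (h.le (h''.trans h'))⟩

theorem Reduced.tail {k : Idx m} {l : List (Idx m)} (h : Reduced (k :: l)) : Reduced l :=
  ⟨rfl, fun l' h' => by
    have := h.le (l' := k :: l') (by rw [wprod_cons, wprod_cons]; exact congrArg _ h')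
    simpa using this⟩

theorem Reduced.descent {k : Idx m} {l : List (Idx m)} (h : Reduced (k :: l)) :
    Descent (wprod (k :: l)) k := by
  rw [wprod_cons, descent_s_mul]
  intro hd
  obtain ⟨l', hl, h'⟩ := exchange_length hd
  have := h.le (l' := l') (by rw [h', wprod_cons])
  simp at this
  omega

theorem Reduced.cons_of_not_descent {k : Idx m} {l : List (Idx m)} (h : Reduced l)
    (hd : ¬ Descent (wprod l) k) : Reduced (k :: l) := by
  refine ⟨rfl, fun c hc => ?_⟩
  change wprod c = wprod (k :: l) at hc
  rw [wprod_cons] at hc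
  rw [← descent_s_mul, ← hc] at hd
  obtain ⟨c', hl, hc'⟩ := exchange_length hd
  have := h.le (l' := c') (by rw [hc', hc, s_mul_s_mul])
  simp
  omega

theorem Reduced.reverse {l : List (Idx m)} (h : Reduced l) : Reduced l.reverse :=
  ⟨rfl, fun l' h' => by
    have := h.le (l' := l'.reverse) (by
      rw [wprod_reverse, inv_eq_iff_eq_inv, ← wprod_reverse]; exact h')
    simpa using this⟩

/-- The commutation condition of the simple reflections. -/
def CommCond (k k' : Idx m) : Prop :=
  (1 ≤ k.1 ∧ k.1 + 1 < k'.1) ∨ (k.1 = 0 ∧ 0 < k'.1 ∧ k'.1 ≠ 2)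

theorem idx_cases (k k' : Idx m) (h : k ≠ k') :
    CommCond k k' ∨ CommCond k' k ∨ k'.pos = nxt k ∨ k.pos = nxt k' := by
  have h' : k.1 ≠ k'.1 := fun h' => h (Subtype.ext h')
  simp only [CommCond, Subtype.ext_iff, Idx.pos_val, nxt_val]
  split_ifs <;> omega

theorem nxt_val_of_eq {k : Idx m} (hk : k.1 = 0) : (nxt k).1 = 2 := by rw [nxt_val, if_pos hk]

theorem nxt_val_of_ne {k : Idx m} (hk : k.1 ≠ 0) : (nxt k).1 = k.1 + 1 := by
  rw [nxt_val, if_neg hk]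

/-- Commuting reflections fix each other's roots. For `k = 0` and `k' = 1` the pair of positions
itself moves, from `(0, 2)` to `(-1, 1)`, and only the root is preserved. -/
theorem CommCond.sameRoot {k k' : Idx m} (h : CommCond k k') :
    SameRoot ((s k').1 k.pos) ((s k').1 (nxt k)) k.pos (nxt k) := by
  have hk' : k'.1 ≠ 0 := by rcases h with h | h <;> omega
  simp only [SameRoot, Subtype.ext_iff, flip_val, s_val_of_ne hk', Idx.pos_val]
  rcases h with h | h
  · rw [nxt_val_of_ne (by omega)]
    left; split_ifs <;> omega
  · rw [nxt_val_of_eq h.1]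
    by_cases h1 : k'.1 = 1
    · right; split_ifs <;> omega
    · left; split_ifs <;> omega

theorem CommCond.sameRoot' {k k' : Idx m} (h : CommCond k k') :
    SameRoot ((s k).1 k'.pos) ((s k).1 (nxt k')) k'.pos (nxt k') := by
  have hk' : k'.1 ≠ 0 := by rcases h with h | h <;> omega
  simp only [SameRoot, Subtype.ext_iff, flip_val, nxt_val_of_ne hk', Idx.pos_val]
  rcases h with h | h
  · simp only [s_val_of_ne (k := k) (by omega), nxt_val_of_ne hk', Idx.pos_val]
    left; split_ifs <;> omega
  · simp only [s_val_of_eq h.1, nxt_val_of_ne hk', Idx.pos_val]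
    by_cases h1 : k'.1 = 1
    · right; split_ifs <;> omega
    · left; split_ifs <;> first | omega | contradiction

theorem CommCond.comm {k k' : Idx m} (h : CommCond k k') : s k * s k' = s k' * s k :=
  (mul_s_of_sameRoot h.sameRoot).symm

section Braid

variable {k k' : Idx m}

theorem nxt_eq_succ (h : k'.pos = nxt k) : nxt k' = k'.succ := by
  have h1 := congrArg Subtype.val h
  apply Subtype.ext
  rw [nxt_val, Idx.pos_val] at h1
  rw [nxt_val, Idx.succ_val]
  split_ifs at h1 ⊢ <;> omega

theorem braid_values (h : k'.pos = nxt k) :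
    (s k).1 k.pos = k'.pos ∧ (s k).1 k'.pos = k.pos ∧ (s k).1 k'.succ = k'.succ ∧
    (s k').1 k.pos = k.pos ∧ (s k').1 k'.pos = k'.succ ∧ (s k').1 k'.succ = k'.pos := by
  refine ⟨h ▸ rfl, by rw [h, s_nxt], ?_, ?_, nxt_eq_succ h, by rw [← nxt_eq_succ h, s_nxt]⟩ <;>
  · have h1 := congrArg Subtype.val h
    rw [nxt_val, Idx.pos_val] at h1
    apply Subtype.ext
    rw [s_val]
    simp only [Idx.pos_val, Idx.succ_val]
    split_ifs at h1 ⊢ <;> omega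

/-- The element `s k * s k'` carries the root of `k` to the root of `k'`. -/
theorem braid_mul (h : k'.pos = nxt k) : s k' * s k * s k' = s k * s k' * s k := by
  obtain ⟨h1, h2, h3, h4, h5, h6⟩ := braid_values h
  have : (s k * s k') * s k = s k' * (s k * s k') := mul_s_of_sameRoot (Or.inl (by
    rw [W.mul_apply, W.mul_apply, nxt_eq_succ h, ← h, h4, h5, h3]
    exact ⟨h1, rfl⟩))
  rw [this, mul_assoc]

theorem braid_ne (h : k'.pos = nxt k) : s k * s k' ≠ s k' * s k := by
  intro he
  obtain ⟨h1, h2, h3, h4, h5, h6⟩ := braid_values h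
  have := congrArg (fun w : W m => (w.1 k.pos).1) he
  simp only [W.mul_apply, h4, h1, h5] at this
  simp at this

end Braid

/-- Words that differ by braid moves. -/
inductive BraidEq : List (Idx m) → List (Idx m) → Prop
  | refl (l) : BraidEq l l
  | symm {l l'} : BraidEq l l' → BraidEq l' l
  | trans {l l' l''} : BraidEq l l' → BraidEq l' l'' → BraidEq l l''
  | cons (k) {l l'} : BraidEq l l' → BraidEq (k :: l) (k :: l')
  | comm (k k') (h : CommCond k k') (l) : BraidEq (k :: k' :: l) (k' :: k :: l)
  | braid (k k') (h : k'.pos = nxt k) (l) : BraidEq (k' :: k :: k' :: l) (k :: k' :: k :: l)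

theorem s_injective : Function.Injective (s : Idx m → W m) := by
  intro k k' h
  by_contra hne
  rcases idx_cases k k' hne with hc | hc | hc | hc
  · have h1 := congrArg Subtype.val (congrArg (fun w : W m => w.1 k.pos) h)
    have := k'.2
    have : k.1 ≠ k'.1 := fun h' => hne (Subtype.ext h')
    simp only [s_val, Idx.pos_val] at h1
    rcases hc with hc | hc <;> split_ifs at h1 <;> omega
  · have h1 := congrArg Subtype.val (congrArg (fun w : W m => w.1 k'.pos) h)
    have := k'.2
    have : k.1 ≠ k'.1 := fun h' => hne (Subtype.ext h')
    simp only [s_val, Idx.pos_val] at h1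
    rcases hc with hc | hc <;> split_ifs at h1 <;> omega
  · exact braid_ne hc (by rw [h])
  · exact braid_ne hc (by rw [h])



/-- The exchange condition puts `k'` in front and deletes one letter. The deleted letter is not the
leading `k`, because `s k ≠ s k'`, so `k` survives in second place. -/
theorem Reduced.comm_of_descent {k k' : Idx m} {l : List (Idx m)} (h : Reduced (k :: l))
    (hne : k ≠ k') (hd : Descent (wprod (k :: l)) k') :
    ∃ l', l'.length + 1 = l.length ∧ wprod (k :: l) = wprod (k' :: k :: l') := by
  obtain ⟨l₁, j, l₂, hl, he⟩ := exchange hd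
  cases l₁ with
  | nil =>
    simp only [List.nil_append, List.cons.injEq] at hl
    simp [wprod] at he
    exact absurd (s_injective he) (by rw [← hl.1]; exact hne.symm)
  | cons i l₁ =>
    simp only [List.cons_append, List.cons.injEq] at hl
    obtain ⟨rfl, rfl⟩ := hl
    refine ⟨l₁ ++ l₂, by simp; omega, ?_⟩
    have : wprod (k :: (l₁ ++ j :: l₂)) = wprod (k :: l₁) * s j * wprod l₂ := by
      simp [wprod, mul_assoc]
    rw [this, ← he]
    simp [wprod, mul_assoc]

/-- Matsumoto's theorem, by induction on the length. Words with the same first letter are compared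
through their tails; if the first letters `k ≠ k'` differ, the exchange condition produces
intermediate reduced words that start with the two sides of the relation between `k` and `k'`. The
type is simply laced, so that relation is a commutation or a braid of length three. -/
theorem BraidEq.of_reduced (n : ℕ) : ∀ {l l' : List (Idx m)}, l.length = n → Reduced l →
    Reduced l' → wprod l = wprod l' → BraidEq l l' := by
  induction n using Nat.strong_induction_on with
  | _ n ih =>
  intro l l' hn hl hl' he
  have hlen : l.length = l'.length := le_antisymm (hl.le he.symm) (hl'.le he)
  match l, l' with
  | [], [] => exact .refl _
  | [], _ :: _ => simp at hlen
  | _ :: _, [] => simp at hlen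
  | k :: a, k' :: b =>
  simp only [List.length_cons, Nat.add_right_cancel_iff] at hlen hn
  have key : ∀ (k : Idx m) (a b : List (Idx m)), a.length + 1 = n → Reduced (k :: a) →
      b.length = a.length → wprod b = wprod a → BraidEq (k :: a) (k :: b) := by
    intro k a b ha hr hb hab
    exact .cons k (ih a.length (by omega) rfl hr.tail
      (hr.tail.of_length_le hab hb.le) hab.symm)
  by_cases hk : k = k'
  · subst hk
    rw [wprod_cons, wprod_cons, mul_right_inj] at he
    exact key k a b hn hl hlen.symm he.symm
  have hd' : Descent (wprod (k :: a)) k' := by rw [he]; exact hl'.descent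
  obtain ⟨c, hc, hca⟩ := hl.comm_of_descent hk hd'
  have hcomm : s k * s k' = s k' * s k → BraidEq (k :: k' :: c) (k' :: k :: c) →
      BraidEq (k :: a) (k' :: b) := by
    intro hs hB
    refine (key k a (k' :: c) hn hl (by simp [hc]) ?_).trans
      (hB.trans (key k' b (k :: c) (by omega) hl' (by simp; omega) ?_).symm)
    · rw [wprod_cons, wprod_cons, wprod_cons, ← mul_assoc, ← hs, mul_assoc, mul_right_inj] at hca
      rw [hca, wprod_cons]
    · rw [he, wprod_cons, wprod_cons k', mul_right_inj] at hca
      exact hca.symm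
  -- Exchanging `k` into the word `k' :: k :: c` deletes neither of its first two letters: the first
  -- would give `s k = s k'`, the second that they commute. So the element has a word starting with
  -- `k, k', k`.
  have hbr : s k * s k' ≠ s k' * s k → s k' * s k * s k' = s k * s k' * s k →
      (∀ c, BraidEq (k :: k' :: k :: c) (k' :: k :: k' :: c)) → BraidEq (k :: a) (k' :: b) := by
    intro hs hs' hB
    have hr : Reduced (k' :: k :: c) := hl.of_length_le hca.symm (by simp; omega)
    have hd'' : Descent (wprod (k' :: k :: c)) k := by rw [← hca]; exact hl.descent
    obtain ⟨l₁, j, l₂, hl₁, hj⟩ := exchange hd''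
    match l₁, hl₁, hj with
    | [], hl₁, hj =>
      simp only [List.nil_append, List.cons.injEq] at hl₁
      simp [wprod] at hj
      exact absurd (s_injective hj) (by rw [← hl₁.1]; exact hk)
    | [_], hl₁, hj =>
      simp only [List.cons_append, List.nil_append, List.cons.injEq] at hl₁
      obtain ⟨rfl, rfl, rfl⟩ := hl₁
      simp [wprod] at hj
      exact absurd hj hs
    | _ :: _ :: l₁, hl₁, hj =>
      simp only [List.cons_append, List.cons.injEq] at hl₁
      obtain ⟨rfl, rfl, rfl⟩ := hl₁
      set d := l₁ ++ l₂ with hdef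
      have hdl : d.length + 1 = (l₁ ++ j :: l₂).length := by simp [hdef]; omega
      have hw : wprod (k' :: k :: (l₁ ++ j :: l₂)) = wprod (k :: k' :: k :: d) := by
        have : wprod (k' :: k :: (l₁ ++ j :: l₂)) = wprod (k' :: k :: l₁) * s j * wprod l₂ := by
          simp [wprod, mul_assoc]
        rw [this, ← hj]
        simp [wprod, hdef, mul_assoc]
      have hw1 := hca.trans hw
      have hw2 : wprod (k' :: b) = wprod (k' :: k :: k' :: d) := by
        rw [← he, hw1]
        simp only [wprod_cons, ← mul_assoc, hs']
      refine (key k a (k' :: k :: d) hn hl (by simp; omega) ?_).trans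
        ((hB d).trans (key k' b (k :: k' :: d) (by omega) hl' (by simp; omega) ?_).symm)
      · rw [wprod_cons, wprod_cons k, mul_right_inj] at hw1
        exact hw1.symm
      · rw [wprod_cons, wprod_cons k', mul_right_inj] at hw2
        exact hw2.symm
  rcases idx_cases k k' hk with h | h | h | h
  · exact hcomm h.comm (.comm _ _ h _)
  · exact hcomm h.comm.symm (.symm (.comm _ _ h _))
  · exact hbr (braid_ne h) (braid_mul h) (fun c => .symm (.braid _ _ h c))
  · exact hbr (braid_ne h).symm (braid_mul h).symm (fun c => .braid _ _ h c)

theorem IsReduced.braidEq {l l' : List (Idx m)} {x : W m} (h : IsReduced l x)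
    (h' : IsReduced l' x) : BraidEq l l' :=
  .of_reduced _ rfl h.reduced h'.reduced (h.1.trans h'.1.symm)

theorem wprod_mem (l : List (Idx m)) : wprod l ∈ WD m := by
  induction l with
  | nil => exact one_mem _
  | cons k l ih =>
    rw [wprod_cons]
    exact mul_mem (Subgroup.subset_closure ⟨k, rfl⟩) ih

theorem exists_word {x : W m} (hx : x ∈ WD m) : ∃ l, wprod l = x := by
  induction hx using Subgroup.closure_induction with
  | mem x hx => obtain ⟨k, rfl⟩ := hx; exact ⟨[k], by simp [wprod]⟩
  | one => exact ⟨[], rfl⟩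
  | mul x y _ _ hx hy =>
    obtain ⟨l, rfl⟩ := hx
    obtain ⟨l', rfl⟩ := hy
    exact ⟨l ++ l', by simp [wprod]⟩
  | inv x _ hx =>
    obtain ⟨l, rfl⟩ := hx
    exact ⟨l.reverse, wprod_reverse l⟩

theorem exists_isReduced {x : W m} (hx : x ∈ WD m) : ∃ l, IsReduced l x := by
  have h : ∃ n, ∃ l : List (Idx m), wprod l = x ∧ l.length = n := by
    obtain ⟨l, hl⟩ := exists_word hx
    exact ⟨_, l, hl, rfl⟩
  obtain ⟨l, hl, hn⟩ := Nat.find_spec h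
  exact ⟨l, hl, fun l' hl' => by rw [hn]; exact Nat.find_min' h ⟨l', hl', rfl⟩⟩

end WeylGroup

/-! ### The order of the Weyl group of type D -/

section Card

variable {m : ℕ}

theorem flip_pow_two (m : ℕ) : flip m ^ 2 = 1 := by
  ext l
  simp [pow_two, flip]

theorem support_flip (m : ℕ) : (flip m).support = Finset.univ := by
  ext l
  simp [flip_ne]

theorem card_pos (m : ℕ) : Fintype.card (Pos m) = 2 * m := by
  rw [Fintype.card_coe, Int.card_Icc]
  omega

theorem cycleType_flip (m : ℕ) : (flip m).cycleType = Multiset.replicate m 2 := by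
  have h2 := Equiv.Perm.pow_prime_eq_one_iff (p := 2).1 (flip_pow_two m)
  have h1 := Multiset.eq_replicate_card.2 h2
  have h3 := Equiv.Perm.sum_cycleType (flip m)
  rw [h1, support_flip, Finset.card_univ, card_pos, Multiset.sum_replicate, smul_eq_mul] at h3
  rw [h1]
  congr 1
  omega

/-- The centralizer of a product of `m` disjoint transpositions permutes them and may flip each one;
the centralizer formula for a cycle type counts this. -/
theorem card_W (m : ℕ) : Nat.card (W m) = 2 ^ m * m.factorial := by
  rw [W, Equiv.Perm.nat_card_centralizer, cycleType_flip, card_pos]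
  rcases Nat.eq_zero_or_pos m with rfl | hm
  · simp
  · rw [Multiset.toFinset_replicate, if_neg hm.ne']
    simp [mul_comm]

/-- A quantity that is largest for elements without descents. -/
def height (w : W m) : ℤ := ∑ l : Pos m, l.1 * (w.1 l).1

/-- The rearrangement inequality: only four terms change, and with `a = k.pos`, `b = nxt k` the
increase is `2 (b - a) (w a - w b)`. -/
theorem height_lt {w : W m} {k : Idx m} (h : (w.1 (nxt k)).1 < (w.1 k.pos).1) :
    height w < height (w * s k) := by
  have hab := pos_ne_nxt k
  have hab' := pos_ne_flip_nxt k
  have hlt : k.pos.1 < (nxt k).1 := by rw [nxt_val, Idx.pos_val]; split_ifs <;> omega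
  have hsub : height (w * s k) - height w =
      ∑ l ∈ {k.pos, nxt k, flip m k.pos, flip m (nxt k)},
        (l.1 * (w.1 ((s k).1 l)).1 - l.1 * (w.1 l).1) := by
    rw [height, height, ← Finset.sum_sub_distrib]
    refine (Finset.sum_subset (Finset.subset_univ _) fun l _ hl => ?_).symm
    simp only [Finset.mem_insert, Finset.mem_singleton, not_or] at hl
    rw [W.mul_apply, s_apply_of_ne k hl.1 hl.2.1 hl.2.2.1 hl.2.2.2, sub_self]
  have e1 := flip_ne k.pos
  have e2 := flip_ne (nxt k)
  have e3 : nxt k ≠ flip m k.pos := fun h => hab' (by rw [h, flip_flip])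
  have e4 : flip m k.pos ≠ flip m (nxt k) := fun h => hab ((flip m).injective h)
  rw [Finset.sum_insert (by simp [hab, hab', e1.symm]), Finset.sum_insert (by simp [e3, e2.symm]),
    Finset.sum_insert (by simp [e4]), Finset.sum_singleton] at hsub
  simp only [W.apply_flip, s_pos, s_nxt, flip_val] at hsub
  nlinarith

/-- An element of `W_m` that is increasing on `1, …, m`, up to the condition on `0`. -/
theorem eq_one_of_increasing {w : W m}
    (h : ∀ a b : Pos m, 1 ≤ a.1 → b.1 = a.1 + 1 → (w.1 a).1 < (w.1 b).1)
    (h0 : ∀ a : Pos m, a.1 = 1 → 1 ≤ (w.1 a).1) : w = 1 := by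
  have hlow : ∀ n : ℕ, ∀ a : Pos m, a.1 = n + 1 → a.1 ≤ (w.1 a).1 := by
    intro n
    induction n with
    | zero => intro a ha; have := h0 a (by simpa using ha); omega
    | succ n ih =>
      intro a ha
      have hb := a.bounds
      have h1 := ih (Pos.mk (n + 1) (by omega)) rfl
      have h2 := h (Pos.mk (n + 1) (by omega)) a (by simp) (by simp [ha])
      simp at h1
      push_cast at ha
      omega
  have hup : ∀ n : ℕ, ∀ a : Pos m, a.1 = m - n → 1 ≤ a.1 → (w.1 a).1 ≤ a.1 := by
    intro n
    induction n with
    | zero => intro a ha _; have := (w.1 a).bounds; simp at ha; omega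
    | succ n ih =>
      intro a ha ha'
      have hb := a.bounds
      push_cast at ha
      have h1 := ih (Pos.mk (m - n) (by omega)) rfl (by simp; omega)
      have h2 := h a (Pos.mk (m - n) (by omega)) ha' (by simp; omega)
      simp at h1
      omega
  have hpos : ∀ a : Pos m, 1 ≤ a.1 → w.1 a = a := by
    intro a ha
    have hb := a.bounds
    have h1 := hlow (a.1 - 1).toNat a (by omega)
    have h2 := hup (m - a.1).toNat a (by omega) ha
    exact Subtype.ext (le_antisymm h2 h1)
  apply W.ext
  intro l
  by_cases hl : 1 ≤ l.1
  · exact hpos l hl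
  · have := hpos (flip m l) (by rw [flip_val]; omega)
    rw [W.apply_flip] at this
    exact (flip m).injective this

/-- The sign is taken on all `2m` positions, where a double exchange consists of two transpositions
and `eps` is a single one. This separates `WD m` from `W m`. -/
theorem sign_s (k : Idx m) : Equiv.Perm.sign (s k).1 = 1 := by
  by_cases hk : k.1 = 0
  · rw [s, dif_pos hk]
    have : ∀ (a b : Pos m) (h : b ≠ flip m a), a ≠ b →
        Equiv.Perm.sign (eps a * dswap a b h * eps a).1 = 1 := by
      intro a b h hab
      simp only [Subgroup.coe_mul, map_mul, eps, dswap]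
      rw [Equiv.Perm.sign_swap hab, Equiv.Perm.sign_swap (fun h => hab ((flip m).injective h)),
        Equiv.Perm.sign_swap (flip_ne a).symm]
      rfl
    exact this _ _ _ (fun h => by have := congrArg Subtype.val h; simp at this)
  · rw [s, dif_neg hk]
    have : ∀ (a b : Pos m) (h : b ≠ flip m a), a ≠ b →
        Equiv.Perm.sign (dswap a b h).1 = 1 := by
      intro a b h hab
      simp only [map_mul, dswap]
      rw [Equiv.Perm.sign_swap hab, Equiv.Perm.sign_swap (fun h => hab ((flip m).injective h))]
      rfl
    exact this _ _ _ (fun h => by have := congrArg Subtype.val h; simp at this)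

theorem sign_of_mem_WD {x : W m} (hx : x ∈ WD m) : Equiv.Perm.sign x.1 = 1 := by
  have : WD m ≤ (Equiv.Perm.sign.comp (W m).subtype).ker := by
    rw [WD, Subgroup.closure_le]
    rintro _ ⟨k, rfl⟩
    exact sign_s k
  exact this hx

/-- Every coset of `WD m` contains an element without descents. -/
theorem exists_no_descent (w : W m) :
    ∃ x ∈ WD m, ∀ k : Idx m, ((w * x).1 k.pos).1 < ((w * x).1 (nxt k)).1 := by
  -- A point of the coset with maximal `height` has no descent, since by `height_lt` a descent would
  -- lead to a higher point of the same coset.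
  obtain ⟨x, hx⟩ := Finite.exists_max fun x : WD m => height (w * x.1)
  refine ⟨x.1, x.2, fun k => ?_⟩
  by_contra hlt
  have hne : ((w * x.1).1 k.pos).1 ≠ ((w * x.1).1 (nxt k)).1 := fun h =>
    pos_ne_nxt k ((w * x.1).1.injective (Subtype.ext h))
  have h1 := height_lt (w := w * x.1) (k := k) (by omega)
  have h2 := hx (x * ⟨s k, Subgroup.subset_closure ⟨k, rfl⟩⟩)
  simp only [Subgroup.coe_mul, ← mul_assoc] at h2
  omega

/-- The hypothesis reads `w 0 < w 2` and `w 1 < w 2 < ⋯ < w m`. If `w 1 ≥ 1`, then `w` is increasing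
with positive values on `1, …, m`, hence trivial. Otherwise `w 0 = 1 - w 1 ≥ 1`, and `w * ε_1` is in
the first case. -/
theorem eq_one_or_eq_eps (hm : 1 < m) {w : W m}
    (h : ∀ k : Idx m, (w.1 k.pos).1 < (w.1 (nxt k)).1) :
    w = 1 ∨ w = eps (Pos.mk 1 (by omega)) := by
  set a₁ : Pos m := Pos.mk 1 (by omega) with ha₁
  have hinc : ∀ a b : Pos m, 1 ≤ a.1 → b.1 = a.1 + 1 → (w.1 a).1 < (w.1 b).1 := by
    intro a b ha hb
    have hb' := b.bounds
    have := h ⟨a.1.toNat, by omega, hm⟩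
    have e1 : Idx.pos (⟨a.1.toNat, by omega, hm⟩ : Idx m) = a := by
      apply Subtype.ext; simp; omega
    have e2 : nxt (⟨a.1.toNat, by omega, hm⟩ : Idx m) = b := by
      apply Subtype.ext; rw [nxt_val_of_ne (by simp; omega)]; simp; omega
    rwa [e1, e2] at this
  by_cases h1 : 1 ≤ (w.1 a₁).1
  · left
    refine eq_one_of_increasing hinc fun a ha => ?_
    have : a = a₁ := Subtype.ext ha
    rwa [this]
  · right
    have hz : w * eps a₁ = 1 := by
      refine eq_one_of_increasing (fun a b ha hb => ?_) fun a ha => ?_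
      · have hfix : ∀ b : Pos m, 1 < b.1 → (eps a₁).1 b = b := by
          intro b hb
          apply Subtype.ext
          rw [eps_val]
          simp only [ha₁]
          split_ifs <;> omega
        rw [W.mul_apply, W.mul_apply, hfix b (by omega)]
        by_cases ha' : 1 < a.1
        · rw [hfix a ha']
          exact hinc a b ha hb
        · have hk := h ⟨0, by omega, hm⟩
          have e1 : (eps a₁).1 a = Idx.pos (⟨0, by omega, hm⟩ : Idx m) := by
            apply Subtype.ext
            rw [eps_val, if_pos (by simp [ha₁]; omega)]
            simp [ha₁]
          have e2 : b = nxt (⟨0, by omega, hm⟩ : Idx m) := by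
            apply Subtype.ext; rw [nxt_val_of_eq rfl]; omega
          rwa [e1, e2]
      · have : a = a₁ := Subtype.ext ha
        rw [W.mul_apply, this]
        have e1 : (eps a₁).1 a₁ = flip m a₁ := by
          apply Subtype.ext
          rw [eps_val, if_pos rfl, flip_val]
        rw [e1, W.apply_flip, flip_val]
        omega
    have he : eps a₁ * eps a₁ = 1 := Subtype.ext (Equiv.swap_mul_self _ _)
    exact (eq_inv_of_mul_eq_one_left hz).trans (inv_eq_of_mul_eq_one_left he)

/-- The subgroup is the kernel of the sign: an even element times a suitable element of `WD m` has
no descent, so it is 1 or `ε_1`, and the latter is odd. -/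
theorem index_WD (hm : 1 < m) : (WD m).index = 2 := by
  rw [Subgroup.index_eq_two_iff]
  refine ⟨eps (Pos.mk 1 (by omega)), fun b => ?_⟩
  set ε : W m := eps (Pos.mk 1 (by omega)) with hε
  have hsε : Equiv.Perm.sign ε.1 = -1 := Equiv.Perm.sign_swap (flip_ne _).symm
  have hmem : ∀ w : W m, w ∈ WD m ↔ Equiv.Perm.sign w.1 = 1 := by
    intro w
    refine ⟨sign_of_mem_WD, fun hw => ?_⟩
    obtain ⟨x, hx, hwx⟩ := exists_no_descent w
    rcases eq_one_or_eq_eps hm hwx with h | h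
    · rw [mul_eq_one_iff_eq_inv.1 h]
      exact inv_mem hx
    · have : Equiv.Perm.sign (w * x).1 = 1 := by
        rw [Subgroup.coe_mul, map_mul, hw, sign_of_mem_WD hx, one_mul]
      rw [h, ← hε, hsε] at this
      exact absurd this (by decide)
  rw [hmem, hmem, Subgroup.coe_mul, map_mul, hsε]
  rcases Int.units_eq_one_or (Equiv.Perm.sign b.1) with h | h <;> rw [h] <;> decide

theorem card_WD (hm : m ≠ 0) : Nat.card (WD m) = 2 ^ (m - 1) * m.factorial := by
  by_cases h1 : m = 1
  · subst h1
    have : WD 1 = ⊥ := by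
      rw [WD, eq_bot_iff, Subgroup.closure_le]
      rintro _ ⟨k, rfl⟩
      exact absurd k.2.2 (lt_irrefl _)
    rw [this]
    simp
  · have h := (WD m).card_mul_index
    rw [index_WD (by omega), card_W] at h
    have : 2 ^ m = 2 ^ (m - 1) * 2 := by rw [← pow_succ]; congr 1; omega
    rw [this] at h
    nlinarith

end Card

/-! ### The universal property of the presented algebra -/

section Presentation

variable {I : Type u} {H : Type v} {Γ : InvQuiver I H} {ν : I →₀ ℕ} {m : ℕ}

theorem Seq.ext {i j : Seq Γ ν m} (h : ∀ l, i l = j l) : i = j := Subtype.ext (funext h)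

theorem Seq.act_apply (x : W m) (i : Seq Γ ν m) (l : Pos m) : i.act x l = i ((x⁻¹ : W m).1 l) := rfl

@[simp] theorem Seq.act_one (i : Seq Γ ν m) : i.act 1 = i := Seq.ext fun l => by
  rw [Seq.act_apply, inv_one, W.one_apply]

theorem Seq.act_mul (x y : W m) (i : Seq Γ ν m) : i.act (x * y) = (i.act y).act x :=
  Seq.ext fun l => by rw [Seq.act_apply, Seq.act_apply, Seq.act_apply, mul_inv_rev, W.mul_apply]

theorem Seq.act_s_apply (k : Idx m) (i : Seq Γ ν m) (l : Pos m) : i.act (s k) l = i ((s k).1 l) := by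
  rw [Seq.act_apply, s_inv]

@[simp] theorem Seq.act_s_act_s (k : Idx m) (i : Seq Γ ν m) : (i.act (s k)).act (s k) = i := by
  rw [← Seq.act_mul, s_mul_s, Seq.act_one]

theorem Seq.apply_flip (i : Seq Γ ν m) (l : Pos m) : i (flip m l) = Γ.θ (i l) := (i.2.1 l).symm

theorem Seq.act_s_eq_self {k : Idx m} {i : Seq Γ ν m} (h : i k.pos = i (nxt k)) :
    i.act (s k) = i := by
  apply Seq.ext
  intro l
  rw [Seq.act_s_apply, s_apply]
  split_ifs with h1 h2 h3 h4
  · rw [h1, h]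
  · rw [h2, h]
  · rw [h3, Seq.apply_flip, Seq.apply_flip, h]
  · rw [h4, Seq.apply_flip, Seq.apply_flip, h]
  · rfl

variable {K : Type w} [Field K]

variable (Γ ν K) in
/-- Elements of an algebra that satisfy the defining relations. -/
structure Satisfies {A : Type*} [Ring A] [Algebra K A] (e : Seq Γ ν m → A) (x : Pos m → A)
    (σ : Idx m → A) : Prop where
  sum_idem : ∑ i, e i = 1
  idem_self i : e i * e i = e i
  idem_ne i j (h : i ≠ j) : e i * e j = 0
  sig_idem k i : σ k * e i = e (i.act (s k)) * σ k
  kap_idem l i : x l * e i = e i * x l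
  kap_flip l : x (flip m l) = -x l
  kap_comm l l' : x l * x l' = x l' * x l
  sig_sq k i : σ k * σ k * e i = Γ.Q (i k.pos) (i (nxt k)) (x (nxt k)) (x k.pos) * e i
  sig_comm k k' (h : CommCond k k') : σ k * σ k' = σ k' * σ k
  braid k k' (h : k'.pos = nxt k) i :
    (σ k' * σ k * σ k' - σ k * σ k' * σ k) * e i =
      if i k.pos = i k'.succ then
        Γ.QQuot (i k.pos) (i (nxt k)) (x (nxt k)) (x k.pos) (x k'.succ) * e i
      else 0
  slide k l i : (σ k * x l - x ((s k).1 l) * σ k) * e i = slideConst K k l i • e i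

theorem map_Q {A B : Type*} [Ring A] [Ring B] (φ : A →+* B) (i j : I) (a b : A) :
    φ (Γ.Q i j a b) = Γ.Q i j (φ a) (φ b) := by
  unfold InvQuiver.Q
  split_ifs <;> simp

theorem map_QQuot {A B : Type*} [Ring A] [Ring B] (φ : A →+* B) (i j : I) (a b c : A) :
    φ (Γ.QQuot i j a b c) = Γ.QQuot i j (φ a) (φ b) (φ c) := by
  unfold InvQuiver.QQuot
  split_ifs <;> simp

variable (Γ ν m K) in
theorem satisfies : Satisfies Γ ν K (idem (m := m) K) (kap Γ ν K) (sig Γ ν K) where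
  sum_idem := by
    simpa [idem] using RingQuot.mkAlgHom_rel K (Rel.sum_idem (Γ := Γ) (ν := ν) (m := m) (K := K))
  idem_self i := by
    simpa [idem] using RingQuot.mkAlgHom_rel K (Rel.idem_self (K := K) i)
  idem_ne i j h := by
    simpa [idem] using RingQuot.mkAlgHom_rel K (Rel.idem_ne (K := K) i j h)
  sig_idem k i := by
    simpa [idem, sig] using RingQuot.mkAlgHom_rel K (Rel.sig_idem (K := K) k i)
  kap_idem l i := by
    simpa [idem, kap] using RingQuot.mkAlgHom_rel K (Rel.kap_idem (K := K) l i)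
  kap_flip l := by
    simpa [kap] using RingQuot.mkAlgHom_rel K (Rel.kap_flip (Γ := Γ) (ν := ν) (K := K) l)
  kap_comm l l' := by
    simpa [kap] using RingQuot.mkAlgHom_rel K (Rel.kap_comm (Γ := Γ) (ν := ν) (K := K) l l')
  sig_sq k i := by
    have h := RingQuot.mkAlgHom_rel K (Rel.sig_sq (K := K) k i)
    rw [map_mul, map_mul, map_mul, ← RingHom.coe_coe, map_Q] at h
    exact h
  sig_comm k k' hk := by
    simpa [sig] using RingQuot.mkAlgHom_rel K (Rel.sig_comm (Γ := Γ) (ν := ν) (K := K) k k' hk)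
  braid k k' hk i := by
    have h := RingQuot.mkAlgHom_rel K (Rel.braid (K := K) k k' hk i)
    rw [map_mul, map_sub, map_mul, map_mul, map_mul, map_mul, apply_ite (RingQuot.mkAlgHom K _),
      map_zero, map_mul, ← RingHom.coe_coe, map_QQuot] at h
    exact h
  slide k l i := by
    simpa [sig, kap, idem] using RingQuot.mkAlgHom_rel K (Rel.slide (K := K) k l i)

section Lift

variable {A : Type*} [Ring A] [Algebra K A] {e : Seq Γ ν m → A} {x : Pos m → A} {σ : Idx m → A}

/-- The homomorphism given by elements that satisfy the defining relations. -/
def Satisfies.lift (h : Satisfies Γ ν K e x σ) : R Γ ν m K →ₐ[K] A :=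
  RingQuot.liftAlgHom K ⟨FreeAlgebra.lift K fun g => match g with
    | .idem i => e i
    | .kap l => x l
    | .sig k => σ k, by
    set φ := FreeAlgebra.lift K fun g : Gen Γ ν m => match g with
      | .idem i => e i
      | .kap l => x l
      | .sig k => σ k with hφ
    have he : ∀ i, φ (fidem K i) = e i := fun i => FreeAlgebra.lift_ι_apply _ _
    have hx : ∀ l, φ (fkap Γ ν K l) = x l := fun l => FreeAlgebra.lift_ι_apply _ _
    have hσ : ∀ k, φ (fsig Γ ν K k) = σ k := fun k => FreeAlgebra.lift_ι_apply _ _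
    have hQ := fun i j a b => map_Q (Γ := Γ) (φ : Free Γ ν m K →+* A) i j a b
    have hQ' := fun i j a b c => map_QQuot (Γ := Γ) (φ : Free Γ ν m K →+* A) i j a b c
    simp only [RingHom.coe_coe] at hQ hQ'
    intro a b hab
    cases hab with
    | sum_idem => simpa [he] using h.sum_idem
    | idem_self i => simpa [he] using h.idem_self i
    | idem_ne i j hij => simpa [he] using h.idem_ne i j hij
    | sig_idem k i => simpa [he, hσ] using h.sig_idem k i
    | kap_idem l i => simpa [he, hx] using h.kap_idem l i
    | kap_flip l => simpa [hx] using h.kap_flip l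
    | kap_comm l l' => simpa [hx] using h.kap_comm l l'
    | sig_sq k i => simpa only [map_mul, hQ, he, hx, hσ] using h.sig_sq k i
    | sig_comm k k' hk => simpa [hσ] using h.sig_comm k k' hk
    | braid k k' hk i =>
      simpa only [map_mul, map_sub, hQ', he, hx, hσ, apply_ite φ, map_zero] using h.braid k k' hk i
    | slide k l i =>
      simpa only [map_mul, map_sub, map_smul, he, hx, hσ] using h.slide k l i⟩

@[simp] theorem Satisfies.lift_idem (h : Satisfies Γ ν K e x σ) (i : Seq Γ ν m) :
    h.lift (idem K i) = e i := by
  rw [Satisfies.lift, idem, RingQuot.liftAlgHom_mkAlgHom_apply]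
  exact FreeAlgebra.lift_ι_apply _ _

@[simp] theorem Satisfies.lift_kap (h : Satisfies Γ ν K e x σ) (l : Pos m) :
    h.lift (kap Γ ν K l) = x l := by
  rw [Satisfies.lift, kap, RingQuot.liftAlgHom_mkAlgHom_apply]
  exact FreeAlgebra.lift_ι_apply _ _

@[simp] theorem Satisfies.lift_sig (h : Satisfies Γ ν K e x σ) (k : Idx m) :
    h.lift (sig Γ ν K k) = σ k := by
  rw [Satisfies.lift, sig, RingQuot.liftAlgHom_mkAlgHom_apply]
  exact FreeAlgebra.lift_ι_apply _ _

end Lift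

@[elab_as_elim]
theorem R.induction {P : R Γ ν m K → Prop} (algebraMap : ∀ c : K, P (algebraMap K _ c))
    (idem : ∀ i, P (idem K i)) (kap : ∀ l, P (kap Γ ν K l)) (sig : ∀ k, P (sig Γ ν K k))
    (mul : ∀ a b, P a → P b → P (a * b)) (add : ∀ a b, P a → P b → P (a + b))
    (r : R Γ ν m K) : P r := by
  obtain ⟨a, rfl⟩ := RingQuot.mkAlgHom_surjective K (Rel Γ ν m K) r
  induction a using FreeAlgebra.induction with
  | grade0 c => rw [AlgHom.commutes]; exact algebraMap c
  | grade1 g =>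
    match g with
    | .idem i => exact idem i
    | .kap l => exact kap l
    | .sig k => exact sig k
  | mul a b ha hb => rw [map_mul]; exact mul _ _ ha hb
  | add a b ha hb => rw [map_add]; exact add _ _ ha hb

end Presentation

/-! ### Straightening: the reduced words span the left module -/

section Span

variable {I : Type u} {H : Type v} {Γ : InvQuiver I H} {ν : I →₀ ℕ} {m : ℕ}
variable {K : Type w} [Field K]

theorem idem_mem_F (i : Seq Γ ν m) : idem K i ∈ F Γ ν m K :=
  Algebra.subset_adjoin ⟨i, Or.inl rfl⟩

theorem kap_mul_idem_mem_F (l : Pos m) (i : Seq Γ ν m) :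
    kap Γ ν K l * idem K i ∈ F Γ ν m K :=
  Algebra.subset_adjoin ⟨i, Or.inr ⟨l, rfl⟩⟩

theorem mul_eq_sum_idem (r : R Γ ν m K) : r = ∑ i, r * idem K i := by
  rw [← Finset.mul_sum, (satisfies Γ ν m K).sum_idem, mul_one]

theorem kap_mem_F (l : Pos m) : kap Γ ν K l ∈ F Γ ν m K := by
  rw [mul_eq_sum_idem (kap Γ ν K l)]
  exact sum_mem fun i _ => kap_mul_idem_mem_F l i

theorem Q_mem_F (i j : I) (a b : Pos m) :
    Γ.Q i j (kap Γ ν K a) (kap Γ ν K b) ∈ F Γ ν m K := by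
  have hs := sub_mem (kap_mem_F (Γ := Γ) (ν := ν) (K := K) a) (kap_mem_F b)
  have h1 : (-1 : R Γ ν m K) ∈ F Γ ν m K := neg_mem (one_mem _)
  unfold InvQuiver.Q
  split_ifs
  · exact zero_mem _
  · exact mul_mem (pow_mem h1 _) (pow_mem hs _)

theorem QQuot_mem_F (i j : I) (a b c : Pos m) :
    Γ.QQuot i j (kap Γ ν K a) (kap Γ ν K b) (kap Γ ν K c) ∈ F Γ ν m K := by
  have hs := sub_mem (kap_mem_F (Γ := Γ) (ν := ν) (K := K) a) (kap_mem_F b)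
  have hs' := sub_mem (kap_mem_F (Γ := Γ) (ν := ν) (K := K) a) (kap_mem_F c)
  have h1 : (-1 : R Γ ν m K) ∈ F Γ ν m K := neg_mem (one_mem _)
  unfold InvQuiver.QQuot
  split_ifs
  · exact zero_mem _
  · exact mul_mem (pow_mem h1 _) (neg_mem (sum_mem fun p _ =>
      mul_mem (pow_mem hs _) (pow_mem hs' _)))

@[elab_as_elim]
theorem F.induction {P : ∀ f, f ∈ F Γ ν m K → Prop}
    (algebraMap : ∀ c : K, P (algebraMap K _ c) (Subalgebra.algebraMap_mem _ c))
    (idem : ∀ i, P (idem K i) (idem_mem_F i)) (kap : ∀ l, P (kap Γ ν K l) (kap_mem_F l))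
    (mul : ∀ a b ha hb, P a ha → P b hb → P (a * b) (mul_mem ha hb))
    (add : ∀ a b ha hb, P a ha → P b hb → P (a + b) (add_mem ha hb))
    {f : R Γ ν m K} (hf : f ∈ F Γ ν m K) : P f hf := by
  induction hf using Algebra.adjoin_induction with
  | mem f hf =>
    obtain ⟨i, rfl | ⟨l, rfl⟩⟩ := hf
    · exact idem i
    · exact mul _ _ (kap_mem_F l) (idem_mem_F i) (kap l) (idem i)
  | algebraMap c => exact algebraMap c
  | add a b ha hb h h' => exact add a b ha hb h h'
  | mul a b ha hb h h' => exact mul a b ha hb h h'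

theorem idem_comm (i j : Seq Γ ν m) : idem K i * idem K j = idem K j * idem K i := by
  by_cases h : i = j
  · rw [h]
  · rw [(satisfies Γ ν m K).idem_ne i j h, (satisfies Γ ν m K).idem_ne j i (Ne.symm h)]

theorem F.mul_comm {f g : R Γ ν m K} (hf : f ∈ F Γ ν m K) (hg : g ∈ F Γ ν m K) :
    f * g = g * f := by
  have S := satisfies Γ ν m K
  change Commute f g
  induction hf using F.induction with
  | algebraMap c => exact Algebra.commutes c g
  | mul a b _ _ ha hb => exact ha.mul_left hb
  | add a b _ _ ha hb => exact ha.add_left hb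
  | idem i =>
    induction hg using F.induction with
    | algebraMap c => exact (Algebra.commutes c _).symm
    | mul a b _ _ ha hb => exact ha.mul_right hb
    | add a b _ _ ha hb => exact ha.add_right hb
    | idem j => exact idem_comm i j
    | kap l => exact (S.kap_idem l i).symm
  | kap l =>
    induction hg using F.induction with
    | algebraMap c => exact (Algebra.commutes c _).symm
    | mul a b _ _ ha hb => exact ha.mul_right hb
    | add a b _ _ ha hb => exact ha.add_right hb
    | idem j => exact S.kap_idem l j
    | kap l' => exact S.kap_comm l l'

/-- Built on the existing ring structure, so the module structure of the algebra over `F` is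
unchanged. -/
instance : CommRing (F Γ ν m K) :=
  { (inferInstance : Ring (F Γ ν m K)) with
    mul_comm := fun f g => Subtype.ext (F.mul_comm f.2 g.2) }

/-- It suffices to move `σ_k` past a generator. The corrections combine like a twisted derivation:
for a product `a * b` the error is `g * h' + h * b`. -/
theorem sig_mul_F (k : Idx m) {f : R Γ ν m K} (hf : f ∈ F Γ ν m K) :
    ∃ g ∈ F Γ ν m K, ∃ h ∈ F Γ ν m K, sig Γ ν K k * f = g * sig Γ ν K k + h := by
  have S := satisfies Γ ν m K
  induction hf using F.induction with
  | algebraMap c =>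
    exact ⟨_, Subalgebra.algebraMap_mem _ c, 0, zero_mem _, by
      rw [add_zero, Algebra.commutes]⟩
  | idem i => exact ⟨_, idem_mem_F _, 0, zero_mem _, by rw [add_zero, S.sig_idem]⟩
  | kap l =>
    refine ⟨_, kap_mem_F ((s k).1 l), ∑ i, slideConst K k l i • idem K i,
      sum_mem fun i _ => Subalgebra.smul_mem _ (idem_mem_F i) _, ?_⟩
    rw [← sub_eq_iff_eq_add', mul_eq_sum_idem (_ - _)]
    exact Finset.sum_congr rfl fun i _ => S.slide k l i
  | mul a b _ _ ha hb =>
    obtain ⟨g, hg, h, hh, e⟩ := ha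
    obtain ⟨g', hg', h', hh', e'⟩ := hb
    refine ⟨g * g', mul_mem hg hg', g * h' + h * b, ?_, ?_⟩
    · exact add_mem (mul_mem hg hh') (mul_mem hh ‹_›)
    · rw [← mul_assoc, e, add_mul, mul_assoc, e']
      noncomm_ring
  | add a b _ _ ha hb =>
    obtain ⟨g, hg, h, hh, e⟩ := ha
    obtain ⟨g', hg', h', hh', e'⟩ := hb
    refine ⟨g + g', add_mem hg hg', h + h', add_mem hh hh', ?_⟩
    rw [mul_add, e, e']
    noncomm_ring

variable (Γ ν K) in
/-- The product of the `σ_k` over a word. -/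
abbrev sigProd (l : List (Idx m)) : R Γ ν m K := (l.map (sig Γ ν K)).prod

theorem sigProd_cons (k : Idx m) (l : List (Idx m)) :
    sigProd Γ ν K (k :: l) = sig Γ ν K k * sigProd Γ ν K l := by
  simp [sigProd]

theorem sigWord_eq (l : List (Idx m)) : sigWord Γ ν K l = sigProd Γ ν K l := by
  rw [sigWord, ← Finset.sum_mul, (satisfies Γ ν m K).sum_idem, one_mul]

variable (Γ ν m K) in
/-- The span of the products of at most `n` of the `σ_k`. -/
def filt (n : ℕ) : Submodule (F Γ ν m K) (R Γ ν m K) :=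
  Submodule.span _ {r | ∃ l : List (Idx m), l.length ≤ n ∧ r = sigProd Γ ν K l}

theorem sigProd_mem_filt {l : List (Idx m)} {n : ℕ} (h : l.length ≤ n) :
    sigProd Γ ν K l ∈ filt Γ ν m K n := Submodule.subset_span ⟨l, h, rfl⟩

theorem filt_mono {n n' : ℕ} (h : n ≤ n') : filt Γ ν m K n ≤ filt Γ ν m K n' :=
  Submodule.span_mono fun _ ⟨l, hl, e⟩ => ⟨l, hl.trans h, e⟩

theorem mul_mem_submodule {N : Submodule (F Γ ν m K) (R Γ ν m K)} {f r : R Γ ν m K}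
    (hf : f ∈ F Γ ν m K) (hr : r ∈ N) : f * r ∈ N := N.smul_mem (⟨f, hf⟩ : F Γ ν m K) hr

theorem sig_mul_mem_filt (k : Idx m) {n : ℕ} {r : R Γ ν m K} (hr : r ∈ filt Γ ν m K n) :
    sig Γ ν K k * r ∈ filt Γ ν m K (n + 1) := by
  induction hr using Submodule.span_induction with
  | mem r hr =>
    obtain ⟨l, hl, rfl⟩ := hr
    rw [← sigProd_cons]
    exact sigProd_mem_filt (by simpa using hl)
  | zero => rw [mul_zero]; exact zero_mem _
  | add a b _ _ ha hb => rw [mul_add]; exact add_mem ha hb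
  | smul f r hr h =>
    obtain ⟨g, hg, g', hg', e⟩ := sig_mul_F k f.2
    rw [Subalgebra.smul_def, smul_eq_mul, ← mul_assoc, e, add_mul, mul_assoc]
    exact add_mem (mul_mem_submodule hg h)
      (mul_mem_submodule hg' (filt_mono n.le_succ hr))

theorem sig_sq_mem_F (k : Idx m) : sig Γ ν K k * sig Γ ν K k ∈ F Γ ν m K := by
  rw [mul_eq_sum_idem (_ * _)]
  refine sum_mem fun i _ => ?_
  rw [(satisfies Γ ν m K).sig_sq]
  exact mul_mem (Q_mem_F _ _ _ _) (idem_mem_F i)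

theorem braid_mem_F {k k' : Idx m} (h : k'.pos = nxt k) :
    sig Γ ν K k' * sig Γ ν K k * sig Γ ν K k' - sig Γ ν K k * sig Γ ν K k' * sig Γ ν K k ∈
      F Γ ν m K := by
  rw [mul_eq_sum_idem (_ - _)]
  refine sum_mem fun i _ => ?_
  rw [(satisfies Γ ν m K).braid k k' h]
  split_ifs
  · exact mul_mem (QQuot_mem_F _ _ _ _ _) (idem_mem_F i)
  · exact zero_mem _

theorem BraidEq.length_eq {l l' : List (Idx m)} (h : BraidEq l l') : l.length = l'.length := by
  induction h <;> simp_all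

/-- A commutation costs nothing, and a braid of three letters costs an element of `F` in their
place; multiplying on the left by `σ_k` raises the filtration by one only. -/
theorem BraidEq.sub_mem {l l' : List (Idx m)} (h : BraidEq l l') :
    ∀ n, l.length ≤ n + 1 → sigProd Γ ν K l - sigProd Γ ν K l' ∈ filt Γ ν m K n := by
  induction h with
  | refl l => intro n _; rw [sub_self]; exact zero_mem _
  | symm h ih =>
    intro n hn
    rw [← neg_sub]
    exact neg_mem (ih n (h.length_eq ▸ hn))
  | trans h h' ih ih' =>
    intro n hn
    rw [← sub_add_sub_cancel]
    exact add_mem (ih n hn) (ih' n (h.length_eq ▸ hn))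
  | @cons k l l' h ih =>
    intro n hn
    cases n with
    | zero =>
      have h1 : l.length = 0 := by simpa using hn
      have h2 := h.length_eq
      rw [h1] at h2
      rw [List.length_eq_zero_iff.1 h1, List.length_eq_zero_iff.1 h2.symm, sub_self]
      exact zero_mem _
    | succ n =>
      rw [sigProd_cons, sigProd_cons, ← mul_sub]
      exact sig_mul_mem_filt k (ih n (by simpa using hn))
  | comm k k' h l =>
    intro n _
    rw [sigProd_cons, sigProd_cons, sigProd_cons, sigProd_cons, ← mul_assoc, ← mul_assoc,
      (satisfies Γ ν m K).sig_comm k k' h, sub_self]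
    exact zero_mem _
  | braid k k' h l =>
    intro n hn
    simp only [sigProd_cons, ← mul_assoc]
    rw [← sub_mul]
    exact mul_mem_submodule (braid_mem_F h) (sigProd_mem_filt (by simp at hn; omega))

/-- If `l` is reduced and `k` is a descent, then `l` is braid equivalent to some `k :: l'`. Up to
shorter words `σ_k σ_l` is then `σ_k ^ 2 σ_{l'}`, with `σ_k ^ 2` in `F`. -/
theorem reduced_or_mem_filt (l : List (Idx m)) :
    Reduced l ∨ ∃ n, n + 1 = l.length ∧ sigProd Γ ν K l ∈ filt Γ ν m K n := by
  induction l with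
  | nil => exact Or.inl ⟨rfl, fun _ _ => Nat.zero_le _⟩
  | cons k l ih =>
    rcases ih with h | ⟨n, hn, h⟩
    · by_cases hd : Descent (wprod l) k
      · right
        obtain ⟨l', hl', he⟩ := exchange_length hd
        have hw : wprod (k :: l') = wprod l := by rw [wprod_cons, he, s_mul_s_mul]
        have hB := BraidEq.of_reduced _ rfl h (h.of_length_le hw (by simp; omega)) hw.symm
        have h1 := sig_mul_mem_filt (Γ := Γ) (ν := ν) (K := K) k
          (hB.sub_mem l'.length (by omega))
        refine ⟨l'.length + 1, by simp; omega, ?_⟩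
        rw [mul_sub, sigProd_cons k l', ← mul_assoc] at h1
        rw [sigProd_cons]
        have h2 := mul_mem_submodule (sig_sq_mem_F (Γ := Γ) (ν := ν) (K := K) k)
          (filt_mono (Nat.le_succ _) (sigProd_mem_filt (Γ := Γ) (ν := ν) (K := K) (le_refl l'.length)))
        simpa using add_mem h1 h2
      · exact Or.inl (h.cons_of_not_descent hd)
    · right
      refine ⟨n + 1, by simp [hn], ?_⟩
      rw [sigProd_cons]
      exact sig_mul_mem_filt k h

theorem mem_span_sigProd (r : R Γ ν m K) :
    r ∈ Submodule.span (F Γ ν m K) (Set.range (sigProd (m := m) Γ ν K)) := by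
  -- The span contains 1, so it is enough that left multiplication by each generator preserves it.
  suffices h : ∀ y ∈ Submodule.span (F Γ ν m K) (Set.range (sigProd (m := m) Γ ν K)),
      r * y ∈ Submodule.span (F Γ ν m K) (Set.range (sigProd (m := m) Γ ν K)) by
    simpa using h 1 (Submodule.subset_span ⟨[], by simp [sigProd]⟩)
  induction r using R.induction with
  | algebraMap c => exact fun y hy => mul_mem_submodule (Subalgebra.algebraMap_mem _ c) hy
  | idem i => exact fun y hy => mul_mem_submodule (idem_mem_F i) hy
  | kap l => exact fun y hy => mul_mem_submodule (kap_mem_F l) hy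
  | sig k =>
    intro y hy
    induction hy using Submodule.span_induction with
    | mem r hr =>
      obtain ⟨l, rfl⟩ := hr
      rw [← sigProd_cons]
      exact Submodule.subset_span ⟨_, rfl⟩
    | zero => rw [mul_zero]; exact zero_mem _
    | add a b _ _ ha hb => rw [mul_add]; exact add_mem ha hb
    | smul f r hr h =>
      obtain ⟨g, hg, g', hg', e⟩ := sig_mul_F k f.2
      rw [Subalgebra.smul_def, smul_eq_mul, ← mul_assoc, e, add_mul, mul_assoc]
      exact add_mem (mul_mem_submodule hg h) (mul_mem_submodule hg' hr)
  | mul a b ha hb => intro y hy; rw [mul_assoc]; exact ha _ (hb _ hy)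
  | add a b ha hb => intro y hy; rw [add_mul]; exact add_mem (ha _ hy) (hb _ hy)

theorem span_dot_eq_top {dot : WD m → List (Idx m)} (hdot : ∀ x, IsReduced (dot x) x) :
    Submodule.span (F Γ ν m K) (Set.range fun x => sigProd Γ ν K (dot x)) = ⊤ := by
  set N := Submodule.span (F Γ ν m K) (Set.range fun x => sigProd Γ ν K (dot x)) with hN
  have key : ∀ n, filt Γ ν m K n ≤ N := by
    intro n
    induction n with
    | zero =>
      rw [filt, Submodule.span_le]
      rintro _ ⟨l, hl, rfl⟩
      have hl : l = [] := by simpa using hl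
      have h1 := (hdot 1).2 [] rfl
      have h1 : dot 1 = [] := by simpa using h1
      rw [hl, ← h1]
      exact Submodule.subset_span ⟨1, rfl⟩
    | succ n ih =>
      rw [filt, Submodule.span_le]
      rintro _ ⟨l, hl, rfl⟩
      rcases reduced_or_mem_filt (Γ := Γ) (ν := ν) (K := K) l with h | ⟨n', hn', h⟩
      · have hB := h.braidEq (hdot ⟨wprod l, wprod_mem l⟩)
        have h1 := ih (hB.sub_mem n hl)
        have h2 : sigProd Γ ν K (dot ⟨wprod l, wprod_mem l⟩) ∈ N := Submodule.subset_span ⟨_, rfl⟩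
        simpa using add_mem h1 h2
      · exact ih (filt_mono (by omega) h)
  rw [eq_top_iff]
  intro r _
  refine Submodule.span_le.2 ?_ (mem_span_sigProd r)
  rintro _ ⟨l, rfl⟩
  exact key l.length (sigProd_mem_filt le_rfl)

end Span

/-! ### Compatibility of arrow numbers and pairing with the involution -/

section Arrows

variable {I : Type u} {H : Type v} (Γ : InvQuiver I H)

theorem InvQuiver.θ_injective : Function.Injective Γ.θ := fun i j h => by
  rw [← Γ.θ_invol i, h, Γ.θ_invol]

/-- The involution on arrows reverses orientation. This makes the coefficients of `σ_k` and its
degrees depend on the root only, not on the pair of positions that represents it. -/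
theorem InvQuiver.numArrows_θ (i j : I) : Γ.numArrows (Γ.θ i) (Γ.θ j) = Γ.numArrows j i := by
  have hinj : Function.Injective Γ.θH := fun h h' e => by rw [← Γ.θH_invol h, e, Γ.θH_invol]
  rw [numArrows, numArrows,
    ← Set.ncard_image_of_injective {h | Γ.src h = j ∧ Γ.tgt h = i} hinj]
  congr 1
  ext h
  constructor
  · rintro ⟨h1, h2⟩
    refine ⟨Γ.θH h, ⟨?_, ?_⟩, Γ.θH_invol h⟩
    · rw [Γ.src_θH, h2, Γ.θ_invol]
    · rw [Γ.tgt_θH, h1, Γ.θ_invol]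
  · rintro ⟨h, ⟨h1, h2⟩, rfl⟩
    exact ⟨by rw [Γ.src_θH, h2], by rw [Γ.tgt_θH, h1]⟩

theorem InvQuiver.pairing_comm (i j : I) : Γ.pairing i j = Γ.pairing j i := by
  unfold pairing
  by_cases h : i = j
  · rw [h]
  · rw [if_neg h, if_neg (Ne.symm h)]; ring

theorem InvQuiver.pairing_θ (i j : I) : Γ.pairing (Γ.θ i) (Γ.θ j) = Γ.pairing j i := by
  unfold pairing
  rw [Γ.numArrows_θ, Γ.numArrows_θ, Γ.θ_injective.eq_iff]
  by_cases h : i = j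
  · rw [h]
  · rw [if_neg h, if_neg (Ne.symm h)]

end Arrows

/-- A field with an action of `W_m` and elements `x_l` that are permuted by `W_m`. -/
structure Frame (m : ℕ) (K : Type w) [Field K] (L : Type*) [Field L] [Algebra K L] where
  act : W m →* (L ≃ₐ[K] L)
  x : Pos m → L
  act_x (w : W m) (l : Pos m) : act w (x l) = x (w.1 l)
  x_flip (l : Pos m) : x (flip m l) = -x l
  x_injective : Function.Injective x

/-! ### The representation by divided differences and twisted reflections -/

section Representation

variable {I : Type u} {H : Type v} {Γ : InvQuiver I H} {ν : I →₀ ℕ} {m : ℕ}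
variable {K : Type w} [Field K] {L : Type*} [Field L] [Algebra K L]

variable (Γ) in
/-- The coefficient of the reflection in the operator `σ_k`. -/
def reflCoeff (α β : I) (a b : L) : L :=
  if α = β then (a - b)⁻¹ else (b - a) ^ Γ.numArrows β α

/-- The coefficient of the identity in the operator `σ_k`. -/
def idCoeff (α β : I) (a b : L) : L := if α = β then -(a - b)⁻¹ else 0

namespace Frame

variable (Φ : Frame m K L)

theorem x_sub_ne {a b : Pos m} (h : a ≠ b) : Φ.x a - Φ.x b ≠ 0 :=
  sub_ne_zero.2 (Φ.x_injective.ne h)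

theorem act_act (w w' : W m) (y : L) : Φ.act w (Φ.act w' y) = Φ.act (w * w') y := by
  rw [map_mul]; rfl

theorem act_one (y : L) : Φ.act 1 y = y := by rw [map_one]; rfl

theorem act_reflCoeff (w : W m) (α β : I) (a b : Pos m) :
    Φ.act w (reflCoeff Γ α β (Φ.x a) (Φ.x b)) =
      reflCoeff Γ α β (Φ.x (w.1 a)) (Φ.x (w.1 b)) := by
  unfold reflCoeff
  split_ifs <;> simp [Φ.act_x]

theorem act_idCoeff (w : W m) (α β : I) (a b : Pos m) :
    Φ.act w (idCoeff α β (Φ.x a) (Φ.x b)) = idCoeff α β (Φ.x (w.1 a)) (Φ.x (w.1 b)) := by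
  unfold idCoeff
  split_ifs <;> simp [Φ.act_x]

variable (Γ ν) in
/-- The operator `1_i`. -/
def opIdem (i : Seq Γ ν m) : Module.End K (Seq Γ ν m → L) where
  toFun f j := if j = i then f j else 0
  map_add' f g := by ext j; simp only [Pi.add_apply]; split_ifs <;> simp
  map_smul' c f := by ext j; simp

variable (Γ ν) in
/-- The operator `σ_k`. -/
def opSig (k : Idx m) : Module.End K (Seq Γ ν m → L) where
  toFun f j :=
    reflCoeff Γ (j k.pos) (j (nxt k)) (Φ.x k.pos) (Φ.x (nxt k)) * Φ.act (s k) (f (j.act (s k))) +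
      idCoeff (j k.pos) (j (nxt k)) (Φ.x k.pos) (Φ.x (nxt k)) * f j
  map_add' f g := by ext j; simp; ring
  map_smul' c f := by ext j; simp

variable (Γ ν K) in
/-- The operator of multiplication by `a`. -/
abbrev opMul : L →ₐ[K] Module.End K (Seq Γ ν m → L) := Algebra.lsmul K K (Seq Γ ν m → L)

theorem opIdem_apply (i : Seq Γ ν m) (f : Seq Γ ν m → L) (j : Seq Γ ν m) :
    opIdem Γ ν (K := K) i f j = if j = i then f j else 0 := rfl

theorem opSig_apply (k : Idx m) (f : Seq Γ ν m → L) (j : Seq Γ ν m) :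
    Φ.opSig Γ ν k f j =
    reflCoeff Γ (j k.pos) (j (nxt k)) (Φ.x k.pos) (Φ.x (nxt k)) * Φ.act (s k) (f (j.act (s k))) +
      idCoeff (j k.pos) (j (nxt k)) (Φ.x k.pos) (Φ.x (nxt k)) * f j := rfl

theorem opMul_apply (a : L) (f : Seq Γ ν m → L) (j : Seq Γ ν m) :
    opMul Γ ν K a f j = a * f j := rfl

theorem idCoeff_eq_zero_or (k : Idx m) (j : Seq Γ ν m) (a b : L) :
    idCoeff (j k.pos) (j (nxt k)) a b = 0 ∨ j.act (s k) = j := by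
  by_cases h : j k.pos = j (nxt k)
  · exact Or.inr (Seq.act_s_eq_self h)
  · exact Or.inl (if_neg h)

theorem opSig_mul_opIdem (k : Idx m) (i : Seq Γ ν m) :
    Φ.opSig Γ ν k * opIdem Γ ν i = opIdem Γ ν (i.act (s k)) * Φ.opSig Γ ν k := by
  refine LinearMap.ext fun f => funext fun j => ?_
  simp only [Module.End.mul_apply, opSig_apply, opIdem_apply]
  have h1 : j.act (s k) = i ↔ j = i.act (s k) := by
    constructor <;> rintro rfl <;> simp
  rw [h1]
  rcases idCoeff_eq_zero_or k j (Φ.x k.pos) (Φ.x (nxt k)) with h | h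
  · rw [h]; split_ifs <;> simp
  · have h2 : j = i ↔ j = i.act (s k) := by rw [← h1, h]
    rw [h2]; split_ifs <;> simp

/-- The slide relation after its reflection terms have cancelled. -/
theorem idCoeff_mul_sub (k : Idx m) (l : Pos m) (i : Seq Γ ν m) :
    idCoeff (i k.pos) (i (nxt k)) (Φ.x k.pos) (Φ.x (nxt k)) * (Φ.x l - Φ.x ((s k).1 l)) =
      algebraMap K L (slideConst K k l i) := by
  unfold idCoeff slideConst
  split_ifs with h h1 h2
  · have hne := Φ.x_sub_ne (pos_ne_nxt k)
    rcases h1 with rfl | rfl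
    · rw [s_pos, map_neg, map_one, neg_mul, inv_mul_cancel₀ hne]
    · rw [W.apply_flip, s_nxt, Φ.x_flip, Φ.x_flip, map_neg, map_one, neg_mul,
        show -Φ.x (nxt k) - -Φ.x k.pos = Φ.x k.pos - Φ.x (nxt k) by ring, inv_mul_cancel₀ hne]
  · have hne := Φ.x_sub_ne (pos_ne_nxt k)
    rcases h2 with rfl | rfl
    · rw [s_nxt, map_one, ← neg_sub (Φ.x k.pos), neg_mul_neg, inv_mul_cancel₀ hne]
    · rw [W.apply_flip, s_pos, Φ.x_flip, Φ.x_flip, map_one,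
        show -Φ.x k.pos - -Φ.x (nxt k) = -(Φ.x k.pos - Φ.x (nxt k)) by ring, neg_mul_neg,
        inv_mul_cancel₀ hne]
  · rw [not_or] at h1 h2
    rw [s_apply_of_ne k h1.1 h2.1 h2.2 h1.2, sub_self, mul_zero, map_zero]
  · rw [zero_mul, map_zero]

/-- Where the vertices agree, a divided difference has square zero. Where they differ, the exponents
`h_{β,α}` and, after the reflection, `h_{α,β}` multiply up to `Q`; taking the arrows in one
direction only in each coefficient splits `Q` between the two factors. -/
theorem opSig_sq (k : Idx m) (f : Seq Γ ν m → L) (j : Seq Γ ν m) :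
    Φ.opSig Γ ν k (Φ.opSig Γ ν k f) j =
      Γ.Q (j k.pos) (j (nxt k)) (Φ.x (nxt k)) (Φ.x k.pos) * f j := by
  simp only [opSig_apply, map_add, map_mul, act_reflCoeff, act_idCoeff, s_pos, s_nxt,
    Seq.act_s_apply, Seq.act_s_act_s, act_act, s_mul_s, act_one]
  unfold reflCoeff idCoeff InvQuiver.Q
  by_cases h : j k.pos = j (nxt k)
  · simp only [h, if_true]
    rw [← neg_sub (Φ.x k.pos), inv_neg]
    ring
  · rw [if_neg h, if_neg h, if_neg h, if_neg (Ne.symm h), if_neg (Ne.symm h), pow_add,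
      ← neg_sub (Φ.x (nxt k)), neg_pow]
    ring

theorem reflCoeff_sameRoot {k : Idx m} {p q : Pos m} (h : SameRoot p q k.pos (nxt k))
    (j : Seq Γ ν m) :
    reflCoeff Γ (j p) (j q) (Φ.x p) (Φ.x q) =
      reflCoeff Γ (j k.pos) (j (nxt k)) (Φ.x k.pos) (Φ.x (nxt k)) := by
  rcases h with ⟨rfl, rfl⟩ | ⟨rfl, rfl⟩
  · rfl
  · unfold reflCoeff
    rw [Seq.apply_flip, Seq.apply_flip, Γ.θ_injective.eq_iff, Γ.numArrows_θ, Φ.x_flip, Φ.x_flip]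
    simp only [eq_comm (a := j (nxt k))]
    split_ifs
    · congr 1; ring
    · congr 1; ring

theorem idCoeff_sameRoot {k : Idx m} {p q : Pos m} (h : SameRoot p q k.pos (nxt k))
    (j : Seq Γ ν m) :
    idCoeff (j p) (j q) (Φ.x p) (Φ.x q) =
      idCoeff (j k.pos) (j (nxt k)) (Φ.x k.pos) (Φ.x (nxt k)) := by
  rcases h with ⟨rfl, rfl⟩ | ⟨rfl, rfl⟩
  · rfl
  · unfold idCoeff
    rw [Seq.apply_flip, Seq.apply_flip, Γ.θ_injective.eq_iff, Φ.x_flip, Φ.x_flip]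
    simp only [eq_comm (a := j (nxt k))]
    split_ifs
    · congr 2; ring
    · rfl

/-- Each reflection fixes the other root, hence the coefficients of the other operator, including
the flipped case of `s_0` and `s_1`. -/
theorem opSig_comm {k k' : Idx m} (h : CommCond k k') :
    Φ.opSig Γ ν k * Φ.opSig Γ ν k' = Φ.opSig Γ ν k' * Φ.opSig Γ ν k := by
  refine LinearMap.ext fun f => funext fun j => ?_
  simp only [Module.End.mul_apply, opSig_apply, map_add, map_mul, act_reflCoeff, act_idCoeff,
    Seq.act_s_apply, act_act, Φ.reflCoeff_sameRoot h.sameRoot, Φ.reflCoeff_sameRoot h.sameRoot',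
    Φ.idCoeff_sameRoot h.sameRoot, Φ.idCoeff_sameRoot h.sameRoot', ← Seq.act_mul, h.comm]
  ring

/-- Both sides are combinations of the six elements of the symmetric group generated by `s k` and `s
k'`. Comparing coefficients leaves rational identities in three variables, one for each pattern of
equalities among three vertices. -/
theorem opSig_braid {k k' : Idx m} (h : k'.pos = nxt k) (f : Seq Γ ν m → L) (j : Seq Γ ν m) :
    Φ.opSig Γ ν k' (Φ.opSig Γ ν k (Φ.opSig Γ ν k' f)) j -
      Φ.opSig Γ ν k (Φ.opSig Γ ν k' (Φ.opSig Γ ν k f)) j =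
    if j k.pos = j k'.succ then
      Γ.QQuot (j k.pos) (j (nxt k)) (Φ.x (nxt k)) (Φ.x k.pos) (Φ.x k'.succ) * f j
    else 0 := by
  obtain ⟨h1, h2, h3, h4, h5, h6⟩ := braid_values h
  have hs := nxt_eq_succ h
  have hm := braid_mul h
  have hab : k.pos ≠ k'.pos := h ▸ pos_ne_nxt k
  have hbc : k'.pos ≠ k'.succ := hs ▸ pos_ne_nxt k'
  have hac : k.pos ≠ k'.succ := fun e => hbc (h1.symm.trans (by rw [e, h3]))
  simp only [opSig_apply, map_add, map_mul, act_reflCoeff, act_idCoeff, Seq.act_s_apply, hs, ← h,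
    h1, h2, h3, h4, h5, h6]
  simp only [act_act, ← Seq.act_mul, s_mul_s, act_one, Seq.act_one, ← mul_assoc (s _), hm]
  have huv := Φ.x_sub_ne hab
  have hvw := Φ.x_sub_ne hbc
  have huw := Φ.x_sub_ne hac
  -- The six translates of `f` may be treated as independent unknowns.
  generalize Φ.act (s k * s k' * s k) (f (j.act (s k * s k' * s k))) = y₁
  generalize Φ.act (s k' * s k) (f (j.act (s k * s k'))) = y₂
  generalize Φ.act (s k * s k') (f (j.act (s k' * s k))) = y₃
  generalize Φ.act (s k) (f (j.act (s k))) = y₄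
  generalize Φ.act (s k') (f (j.act (s k'))) = y₅
  generalize f j = y₆
  generalize Φ.x k.pos = u at *
  generalize Φ.x k'.pos = v at *
  generalize Φ.x k'.succ = w at *
  generalize j k.pos = α at *
  generalize j k'.pos = β at *
  generalize j k'.succ = γ at *
  clear h1 h2 h3 h4 h5 h6 hs hm hab hbc hac
  have huv' : v - u ≠ 0 := by rwa [← neg_sub, neg_ne_zero]
  have hvw' : w - v ≠ 0 := by rwa [← neg_sub, neg_ne_zero]
  have huw' : w - u ≠ 0 := by rwa [← neg_sub, neg_ne_zero]
  by_cases h1 : α = γ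
  · subst h1
    by_cases h2 : α = β
    · subst h2
      simp only [reflCoeff, idCoeff, InvQuiver.QQuot, if_true]
      rw [← neg_sub u v, ← neg_sub v w]
      simp only [inv_neg]
      field_simp
      ring
    · have hQ : Γ.QQuot α β v u w = (Γ.Q α β v u - Γ.Q α β v w) / (u - w) := by
        rw [← Γ.sub_mul_QQuot, mul_div_cancel_left₀ _ huw]
      have h2' := Ne.symm h2
      rw [hQ]
      simp only [reflCoeff, idCoeff, InvQuiver.Q, if_true, if_neg h2, if_neg h2']
      rw [← neg_sub v u, ← neg_sub v w, neg_pow (v - u), neg_pow (v - w), pow_add, pow_add]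
      field_simp
      ring
  · rw [if_neg h1]
    have h1' := Ne.symm h1
    by_cases h2 : α = β
    · subst h2
      simp only [reflCoeff, idCoeff, if_true, if_neg h1, if_neg h1']
      rw [← neg_sub u v]
      simp only [inv_neg]
      field_simp
      ring
    · have h2' := Ne.symm h2
      by_cases h3 : β = γ
      · subst h3
        simp only [reflCoeff, idCoeff, if_true, if_neg h2, if_neg h2']
        rw [← neg_sub v w]
        simp only [inv_neg]
        field_simp
        ring
      · have h3' := Ne.symm h3
        simp only [reflCoeff, idCoeff, if_neg h1, if_neg h2, if_neg h2', if_neg h3, if_neg h3']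
        ring

/-- The operators satisfy the defining relations. -/
theorem satisfies : Satisfies Γ ν K (opIdem Γ ν) (fun l => opMul Γ ν K (Φ.x l)) (Φ.opSig Γ ν) where
  sum_idem := by
    refine LinearMap.ext fun f => funext fun j => ?_
    simp [opIdem_apply]
  idem_self i := by
    refine LinearMap.ext fun f => funext fun j => ?_
    simp only [Module.End.mul_apply, opIdem_apply]
    split_ifs <;> rfl
  idem_ne i j h := by
    refine LinearMap.ext fun f => funext fun j' => ?_
    simp only [Module.End.mul_apply, opIdem_apply]
    split_ifs with h1 h2
    · exact absurd (h1.symm.trans h2) h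
    · rfl
    · rfl
  sig_idem k i := Φ.opSig_mul_opIdem k i
  kap_idem l i := by
    refine LinearMap.ext fun f => funext fun j => ?_
    simp only [Module.End.mul_apply, opIdem_apply, opMul_apply]
    split_ifs <;> simp
  kap_flip l := by rw [Φ.x_flip, map_neg]
  kap_comm l l' := by rw [← map_mul, mul_comm, map_mul]
  sig_sq k i := by
    refine LinearMap.ext fun f => funext fun j => ?_
    have := map_Q (Γ := Γ) ((opMul Γ ν K : L →ₐ[K] Module.End K (Seq Γ ν m → L)) :
      L →+* Module.End K (Seq Γ ν m → L))
    simp only [RingHom.coe_coe] at this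
    rw [← this]
    simp only [Module.End.mul_apply, opSig_sq, opMul_apply, opIdem_apply]
    split_ifs with h
    · rw [h]
    · simp
  sig_comm k k' h := Φ.opSig_comm h
  braid k k' h i := by
    refine LinearMap.ext fun f => funext fun j => ?_
    have := map_QQuot (Γ := Γ) ((opMul Γ ν K : L →ₐ[K] Module.End K (Seq Γ ν m → L)) :
      L →+* Module.End K (Seq Γ ν m → L))
    simp only [RingHom.coe_coe] at this
    rw [← this]
    simp only [Module.End.mul_apply, LinearMap.sub_apply, Pi.sub_apply, Φ.opSig_braid h]
    by_cases hj : j = i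
    · subst hj
      split_ifs
      · simp only [Module.End.mul_apply, opMul_apply, opIdem_apply]
      · rfl
    · rw [opIdem_apply, if_neg hj]
      split_ifs <;> simp [opMul_apply, opIdem_apply, hj]
  slide k l i := by
    refine LinearMap.ext fun f => funext fun j => ?_
    have := Φ.idCoeff_mul_sub k l j
    simp only [Module.End.mul_apply, LinearMap.sub_apply, Pi.sub_apply, opSig_apply, opMul_apply,
      map_mul, Φ.act_x]
    rw [LinearMap.smul_apply, Pi.smul_apply, Algebra.smul_def]
    by_cases hj : j = i
    · subst hj
      rw [← this]
      ring
    · rw [opIdem_apply i f j, if_neg hj]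
      ring

variable (Γ ν) in
/-- The representation on functions with values in `L`. -/
def rep : R Γ ν m K →ₐ[K] Module.End K (Seq Γ ν m → L) := (Φ.satisfies (Γ := Γ) (ν := ν)).lift

theorem rep_idem (i : Seq Γ ν m) : Φ.rep Γ ν (idem K i) = opIdem Γ ν i := Satisfies.lift_idem _ _

theorem rep_kap (l : Pos m) : Φ.rep Γ ν (kap Γ ν K l) = opMul Γ ν K (Φ.x l) :=
  Satisfies.lift_kap _ _

theorem rep_sig (k : Idx m) : Φ.rep Γ ν (sig Γ ν K k) = Φ.opSig Γ ν k := Satisfies.lift_sig _ _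

variable (Γ ν) in
/-- The coefficient of the group element `v` in the operator attached to a word. -/
def coeff : List (Idx m) → W m → Seq Γ ν m → L
  | [], v, _ => if v = 1 then 1 else 0
  | k :: l, v, j =>
    reflCoeff Γ (j k.pos) (j (nxt k)) (Φ.x k.pos) (Φ.x (nxt k)) *
        Φ.act (s k) (coeff l (s k * v) (j.act (s k))) +
      idCoeff (j k.pos) (j (nxt k)) (Φ.x k.pos) (Φ.x (nxt k)) * coeff l v j

/-- A function that is constant in the sequence does not see how the word permutes sequences, so
only the group elements acting on the field remain. -/
theorem rep_sigProd_const (l : List (Idx m)) (g : L) (j : Seq Γ ν m) :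
    Φ.rep Γ ν (sigProd Γ ν K l) (fun _ => g) j = ∑ v, Φ.coeff Γ ν l v j * Φ.act v g := by
  induction l generalizing j with
  | nil => simp [sigProd, coeff]
  | cons k l ih =>
    rw [sigProd_cons, map_mul, Module.End.mul_apply, rep_sig, opSig_apply, ih, ih, map_sum]
    simp only [coeff, add_mul, Finset.sum_add_distrib, Finset.mul_sum, mul_assoc, map_mul, act_act]
    congr 1
    rw [← Equiv.sum_comp (Equiv.mulLeft (s k))]
    simp only [Equiv.coe_mulLeft, ← map_mul Φ.act, s_mul_s_mul]

/-- Expanding the product, each letter contributes its reflection or the identity; taking the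
identity anywhere leaves a proper subword. -/
theorem exists_of_coeff_ne_zero {l : List (Idx m)} {v : W m} {j : Seq Γ ν m}
    (h : Φ.coeff Γ ν l v j ≠ 0) :
    v = wprod l ∨ ∃ l', l'.length < l.length ∧ wprod l' = v := by
  induction l generalizing v j with
  | nil =>
    left
    by_contra hv
    exact h (if_neg hv)
  | cons k l ih =>
    by_cases h1 : Φ.coeff Γ ν l (s k * v) (j.act (s k)) = 0
    · by_cases h2 : Φ.coeff Γ ν l v j = 0
      · exact absurd (by simp [coeff, h1, h2]) h
      · right
        rcases ih h2 with rfl | ⟨l', hl', rfl⟩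
        · exact ⟨l, by simp, rfl⟩
        · exact ⟨l', by simp; omega, rfl⟩
    · rcases ih h1 with h | ⟨l', hl', h⟩
      · left; rw [wprod_cons, ← h, s_mul_s_mul]
      · right
        exact ⟨k :: l', by simpa using hl', by rw [wprod_cons, h, s_mul_s_mul]⟩

/-- For a reduced word no shorter word gives the same element, so the only contribution takes the
reflection at every letter, and all these coefficients are nonzero. -/
theorem coeff_wprod_ne_zero {l : List (Idx m)} (h : Reduced l) (j : Seq Γ ν m) :
    Φ.coeff Γ ν l (wprod l) j ≠ 0 := by
  induction l generalizing j with
  | nil => simp [coeff, wprod]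
  | cons k l ih =>
    have h0 : Φ.coeff Γ ν l (wprod (k :: l)) j = 0 := by
      by_contra hne
      rcases Φ.exists_of_coeff_ne_zero hne with h1 | ⟨l', hl', h1⟩
      · have := h.le (l' := l) h1.symm
        simp at this
      · have := h.le h1
        simp at this
        omega
    rw [coeff, h0, mul_zero, add_zero, wprod_cons, s_mul_s_mul]
    refine mul_ne_zero ?_ ((map_ne_zero _).2 (ih h.tail _))
    have := Φ.x_sub_ne (pos_ne_nxt k)
    have := Φ.x_sub_ne (pos_ne_nxt k).symm
    unfold reflCoeff
    split_ifs
    · exact inv_ne_zero ‹_›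
    · exact pow_ne_zero _ ‹_›

theorem act_injective : Function.Injective Φ.act := fun w w' h => W.ext fun l =>
  Φ.x_injective (by rw [← Φ.act_x, ← Φ.act_x, h])

/-- Dedekind's independence of characters; the automorphisms are distinct because they permute the
distinct elements `x_l` faithfully. -/
theorem eq_zero_of_sum_act {c : W m → L} (h : ∀ g, ∑ v, c v * Φ.act v g = 0) : c = 0 := by
  have hinj : Function.Injective fun v : W m => ((Φ.act v : L →* L)) := by
    intro v v' he
    apply Φ.act_injective
    ext y
    exact DFunLike.congr_fun he y
  have := (linearIndependent_monoidHom L L).comp _ hinj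
  rw [Fintype.linearIndependent_iff] at this
  refine funext fun v => this c (funext fun g => ?_) v
  simpa using h g

end Frame

end Representation

/-! ### The frame of rational functions in `m` variables -/

section PolynomialFrame

variable {m : ℕ} {K : Type w} [Field K]

variable (K) in
/-- The polynomial `x_l`: a variable for `l ≥ 1`, the opposite of a variable for `l ≤ 0`. -/
def polyX (l : Pos m) : MvPolynomial (Fin m) K :=
  if h : 1 ≤ l.1 then MvPolynomial.X ⟨(l.1 - 1).toNat, by have := l.bounds; omega⟩
  else -MvPolynomial.X ⟨(-l.1).toNat, by have := l.bounds; omega⟩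

theorem polyX_ofFin (i : Fin m) : polyX K (Pos.ofFin i) = MvPolynomial.X i := by
  rw [polyX, dif_pos (by simp [Pos.ofFin])]
  congr 1
  ext
  simp [Pos.ofFin]

theorem polyX_flip (l : Pos m) : polyX K (flip m l) = -polyX K l := by
  by_cases h : 1 ≤ l.1
  · rw [polyX, polyX, dif_pos h, dif_neg (by rw [flip_val]; omega)]
    congr 3
    rw [flip_val]
    omega
  · rw [polyX, polyX, dif_neg h, dif_pos (by rw [flip_val]; omega), neg_neg]
    congr 2
    rw [flip_val]
    omega

theorem exists_ofFin (l : Pos m) : ∃ i : Fin m, l = Pos.ofFin i ∨ l = flip m (Pos.ofFin i) := by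
  have := l.bounds
  by_cases h : 1 ≤ l.1
  · refine ⟨⟨(l.1 - 1).toNat, by omega⟩, Or.inl (Subtype.ext ?_)⟩
    simp [Pos.ofFin]
    omega
  · refine ⟨⟨(-l.1).toNat, by omega⟩, Or.inr (Subtype.ext ?_)⟩
    simp [Pos.ofFin]
    omega

/-- The signs matter: a variable differs from its opposite because 2 is not zero in `K`. -/
theorem polyX_injective [CharZero K] : Function.Injective (polyX (m := m) K) := by
  have hne : ∀ i j : Fin m, (MvPolynomial.X i : MvPolynomial (Fin m) K) ≠ -MvPolynomial.X j := by
    intro i j h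
    have := congrArg (MvPolynomial.eval fun _ => (1 : K)) h
    simp only [map_neg, MvPolynomial.eval_X] at this
    have h2 : (2 : K) = 0 := by linear_combination this
    exact two_ne_zero h2
  intro a b h
  obtain ⟨i, rfl | rfl⟩ := exists_ofFin a <;> obtain ⟨j, rfl | rfl⟩ := exists_ofFin b <;>
    simp only [polyX_flip, polyX_ofFin, neg_inj] at h
  · rw [MvPolynomial.X_injective h]
  · exact absurd h (hne i j)
  · exact absurd h.symm (hne j i)
  · rw [MvPolynomial.X_injective h]

variable (K) in
/-- The action of an element of `W_m` on polynomials. -/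
def polyMap (w : W m) : MvPolynomial (Fin m) K →ₐ[K] MvPolynomial (Fin m) K :=
  MvPolynomial.aeval fun i => polyX K (w.1 (Pos.ofFin i))

theorem polyMap_polyX (w : W m) (l : Pos m) : polyMap K w (polyX K l) = polyX K (w.1 l) := by
  obtain ⟨i, rfl | rfl⟩ := exists_ofFin l
  · rw [polyX_ofFin, polyMap, MvPolynomial.aeval_X]
  · rw [W.apply_flip, polyX_flip, polyX_flip, map_neg, polyX_ofFin, polyMap, MvPolynomial.aeval_X]

theorem polyMap_comp (w w' : W m) :
    (polyMap K w).comp (polyMap K w') = polyMap K (w * w') := by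
  refine MvPolynomial.algHom_ext fun i => ?_
  rw [AlgHom.comp_apply, ← polyX_ofFin, polyMap_polyX, polyMap_polyX, polyMap_polyX, W.mul_apply]

theorem polyMap_one : polyMap K (1 : W m) = AlgHom.id K _ := by
  refine MvPolynomial.algHom_ext fun i => ?_
  rw [← polyX_ofFin, polyMap_polyX, W.one_apply, AlgHom.id_apply]

variable (m K) in
/-- The action of `W_m` on polynomials. -/
def polyAct : W m →* (MvPolynomial (Fin m) K ≃ₐ[K] MvPolynomial (Fin m) K) where
  toFun w := AlgEquiv.ofAlgHom (polyMap K w) (polyMap K w⁻¹)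
    (by rw [polyMap_comp, mul_inv_cancel, polyMap_one])
    (by rw [polyMap_comp, inv_mul_cancel, polyMap_one])
  map_one' := by
    ext1 p
    exact DFunLike.congr_fun polyMap_one p
  map_mul' w w' := by
    ext1 p
    exact (DFunLike.congr_fun (polyMap_comp w w') p).symm

variable (m K) in
/-- The action of `W_m` on rational functions. -/
def polyFrame [CharZero K] : Frame m K (FractionRing (MvPolynomial (Fin m) K)) where
  act := (IsFractionRing.fieldEquivOfAlgEquivHom K _).comp (polyAct m K)
  x l := algebraMap _ _ (polyX K l)
  act_x w l := by
    change IsFractionRing.fieldEquivOfAlgEquiv K _ _ (polyAct m K w) _ = _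
    rw [IsFractionRing.fieldEquivOfAlgEquiv_algebraMap]
    exact congrArg _ (polyMap_polyX w l)
  x_flip l := by rw [polyX_flip, map_neg]
  x_injective := (IsFractionRing.injective _ _).comp polyX_injective

end PolynomialFrame

/-! ### The structure of `F` and the basis of the left module -/

section Basis

variable {I : Type u} {H : Type v} {Γ : InvQuiver I H} {ν : I →₀ ℕ} {m : ℕ}
variable {K : Type w} [Field K]

variable (Γ ν m K) in
/-- The evaluation of polynomials at `ϰ_1, …, ϰ_m`. -/
def evalKap : MvPolynomial (Fin m) K →ₐ[K] F Γ ν m K :=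
  MvPolynomial.aeval fun l => ⟨kap Γ ν K (Pos.ofFin l), kap_mem_F _⟩

theorem evalKap_polyX (l : Pos m) : (evalKap Γ ν m K (polyX K l) : R Γ ν m K) = kap Γ ν K l := by
  obtain ⟨i, rfl | rfl⟩ := exists_ofFin l
  · rw [polyX_ofFin, evalKap, MvPolynomial.aeval_X]
  · rw [polyX_flip, polyX_ofFin, map_neg, evalKap, MvPolynomial.aeval_X,
      (satisfies Γ ν m K).kap_flip]
    rfl

/-- The element `1_i` of the subalgebra `F`. -/
def idemF (i : Seq Γ ν m) : F Γ ν m K := ⟨idem K i, idem_mem_F i⟩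

theorem idemF_mul (i j : Seq Γ ν m) :
    (idemF i * idemF j : F Γ ν m K) = if i = j then idemF i else 0 := by
  apply Subtype.ext
  split_ifs with h
  · subst h; exact (satisfies Γ ν m K).idem_self i
  · exact (satisfies Γ ν m K).idem_ne i j h

theorem sum_idemF : ∑ i, (idemF i : F Γ ν m K) = 1 := by
  apply Subtype.ext
  rw [AddSubmonoidClass.coe_finsetSum]
  exact (satisfies Γ ν m K).sum_idem

variable (Γ ν m K) in
/-- The homomorphism from the direct sum of the polynomial algebras. -/
def polyHom : (Seq Γ ν m → MvPolynomial (Fin m) K) →ₐ[K] F Γ ν m K where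
  toFun p := ∑ i, evalKap Γ ν m K (p i) * idemF i
  map_one' := by
    simp only [Pi.one_apply, map_one, one_mul]
    exact sum_idemF
  map_mul' p q := by
    simp only [Pi.mul_apply, map_mul, Finset.sum_mul_sum]
    refine Finset.sum_congr rfl fun i _ => ?_
    rw [Finset.sum_eq_single i]
    · rw [mul_mul_mul_comm, idemF_mul, if_pos rfl]
    · intro j _ hj
      rw [mul_mul_mul_comm, idemF_mul, if_neg hj.symm, mul_zero]
    · simp
  map_zero' := by simp
  map_add' p q := by simp only [Pi.add_apply, map_add, add_mul, Finset.sum_add_distrib]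
  commutes' c := by
    simp only [Pi.algebraMap_apply, AlgHom.commutes]
    rw [← Finset.mul_sum, sum_idemF, mul_one]

theorem polyHom_apply (p : Seq Γ ν m → MvPolynomial (Fin m) K) :
    polyHom Γ ν m K p = ∑ i, evalKap Γ ν m K (p i) * idemF i := rfl

theorem polyHom_single (i : Seq Γ ν m) (p : MvPolynomial (Fin m) K) :
    polyHom Γ ν m K (Pi.single i p) = evalKap Γ ν m K p * idemF i := by
  rw [polyHom_apply, Finset.sum_eq_single i]
  · rw [Pi.single_eq_same]
  · intro j _ hj
    rw [Pi.single_eq_of_ne hj, map_zero, zero_mul]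
  · simp

theorem polyHom_const (p : MvPolynomial (Fin m) K) :
    polyHom Γ ν m K (fun _ => p) = evalKap Γ ν m K p := by
  rw [polyHom_apply, ← Finset.mul_sum, sum_idemF, mul_one]

theorem polyHom_surjective : Function.Surjective (polyHom Γ ν m K) := by
  rintro ⟨f, hf⟩
  induction hf using F.induction with
  | algebraMap c => exact ⟨_, (polyHom Γ ν m K).commutes c⟩
  | idem i =>
    refine ⟨Pi.single i 1, ?_⟩
    rw [polyHom_single, map_one, one_mul]
    rfl
  | kap l => exact ⟨_, (polyHom_const _).trans (Subtype.ext (evalKap_polyX l))⟩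
  | mul a b ha hb h h' =>
    obtain ⟨p, hp⟩ := h
    obtain ⟨q, hq⟩ := h'
    exact ⟨p * q, by rw [map_mul, hp, hq]; rfl⟩
  | add a b ha hb h h' =>
    obtain ⟨p, hp⟩ := h
    obtain ⟨q, hq⟩ := h'
    exact ⟨p + q, by rw [map_add, hp, hq]; rfl⟩

variable [CharZero K]

theorem rep_evalKap (p : MvPolynomial (Fin m) K) :
    (polyFrame m K).rep Γ ν (evalKap Γ ν m K p) =
      Frame.opMul Γ ν K (algebraMap _ (FractionRing (MvPolynomial (Fin m) K)) p) := by
  have : (((polyFrame m K).rep Γ ν).comp (F Γ ν m K).val).comp (evalKap Γ ν m K) =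
      (Frame.opMul Γ ν K).comp (IsScalarTower.toAlgHom K (MvPolynomial (Fin m) K)
        (FractionRing (MvPolynomial (Fin m) K))) := by
    refine MvPolynomial.algHom_ext fun i => ?_
    change (polyFrame m K).rep Γ ν (evalKap Γ ν m K (MvPolynomial.X i)) = _
    rw [← polyX_ofFin, evalKap_polyX, Frame.rep_kap]
    rfl
  exact DFunLike.congr_fun this p

theorem rep_polyHom_apply (p : Seq Γ ν m → MvPolynomial (Fin m) K)
    (f : Seq Γ ν m → FractionRing (MvPolynomial (Fin m) K)) (j : Seq Γ ν m) :
    (polyFrame m K).rep Γ ν (polyHom Γ ν m K p) f j = algebraMap _ _ (p j) * f j := by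
  rw [polyHom_apply, AddSubmonoidClass.coe_finsetSum, map_sum, LinearMap.sum_apply,
    Finset.sum_apply, Finset.sum_eq_single j]
  · rw [MulMemClass.coe_mul, map_mul, Module.End.mul_apply, rep_evalKap, Frame.opMul_apply, idemF,
      Frame.rep_idem, Frame.opIdem_apply, if_pos rfl]
  · intro i _ hi
    rw [MulMemClass.coe_mul, map_mul, Module.End.mul_apply, rep_evalKap, Frame.opMul_apply, idemF,
      Frame.rep_idem, Frame.opIdem_apply, if_neg hi.symm, mul_zero]
  · simp

/-- Acting on the constant function 1 recovers each polynomial. -/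
theorem polyHom_injective : Function.Injective (polyHom Γ ν m K) := by
  rw [injective_iff_map_eq_zero]
  intro p hp
  funext j
  have := rep_polyHom_apply p (fun _ => 1) j
  rw [hp, ZeroMemClass.coe_zero, map_zero, mul_one] at this
  exact (map_eq_zero_iff _ (IsFractionRing.injective _ _)).1 this.symm

variable (Γ ν m K) in
/-- The subalgebra `F` is the direct sum of the polynomial algebras. -/
def polyEquiv : (Seq Γ ν m → MvPolynomial (Fin m) K) ≃ₐ[K] F Γ ν m K :=
  AlgEquiv.ofBijective (polyHom Γ ν m K) ⟨polyHom_injective, polyHom_surjective⟩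

/-- Triangularity: in a relation, localised at one sequence `j`, the group element of a longest word
that occurs receives a contribution from its own word only. -/
theorem linearIndependent_dot {dot : WD m → List (Idx m)} (hdot : ∀ x, IsReduced (dot x) x) :
    LinearIndependent (F Γ ν m K) fun x => sigProd Γ ν K (dot x) := by
  rw [Fintype.linearIndependent_iff]
  intro g hg
  choose p hp using fun x => polyHom_surjective (g x)
  suffices h : ∀ j x, p x j = 0 by
    intro x
    rw [← hp, show p x = 0 from funext fun j => h j x, map_zero]
  intro j
  by_contra! hne
  obtain ⟨x₀, hx₀⟩ := hne
  obtain ⟨x, hx, hmax⟩ := Finset.exists_max_image (Finset.univ.filter fun x => p x j ≠ 0)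
    (fun x => (dot x).length) ⟨x₀, by simpa using hx₀⟩
  simp only [Finset.mem_filter, Finset.mem_univ, true_and] at hx hmax
  set Φ := polyFrame m K
  -- The relation applied to the constant function `a` and evaluated at `j`, sorted by group
  -- elements.
  have hc : ∀ a, ∑ v, (∑ y, algebraMap _ _ (p y j) * Φ.coeff Γ ν (dot y) v j) * Φ.act v a = 0 := by
    intro a
    have h1 := congrArg (fun r => Φ.rep Γ ν r (fun _ => a) j) hg
    simp only [map_sum, LinearMap.sum_apply, Finset.sum_apply, map_zero] at h1
    rw [LinearMap.zero_apply, Pi.zero_apply] at h1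
    rw [← h1]
    simp only [Finset.sum_mul]
    rw [Finset.sum_comm]
    refine Finset.sum_congr rfl fun y _ => ?_
    rw [Subalgebra.smul_def, smul_eq_mul, map_mul, Module.End.mul_apply, ← hp, rep_polyHom_apply,
      Frame.rep_sigProd_const, Finset.mul_sum]
    simp only [mul_assoc]
  have hz := congrFun (Φ.eq_zero_of_sum_act hc) x.1
  simp only [Pi.zero_apply] at hz
  rw [Finset.sum_eq_single x] at hz
  · have hw := (hdot x).1
    have h2 := Φ.coeff_wprod_ne_zero (Γ := Γ) (ν := ν) (hdot x).reduced j
    rw [wprod, hw] at h2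
    exact mul_ne_zero ((map_ne_zero_iff _ (IsFractionRing.injective _ _)).2 hx) h2 hz
  · intro y _ hy
    by_contra hne
    have h1 : p y j ≠ 0 := fun h => hne (by rw [h, map_zero, zero_mul])
    have h2 : Φ.coeff Γ ν (dot y) x.1 j ≠ 0 := fun h => hne (by rw [h, mul_zero])
    rcases Φ.exists_of_coeff_ne_zero h2 with h | ⟨l', hl', h⟩
    · exact hy (Subtype.ext ((hdot y).1.symm.trans h.symm))
    · have h3 := (hdot x).2 l' h
      have h4 := hmax y h1
      omega
  · simp

/-- The basis of the left module given by a choice of reduced words. -/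
theorem exists_left_basis {dot : WD m → List (Idx m)} (hdot : ∀ x, IsReduced (dot x) x) :
    ∃ b : Module.Basis (WD m) (F Γ ν m K) (R Γ ν m K), ∀ x, b x = sigWord Γ ν K (dot x) :=
  ⟨.mk (linearIndependent_dot hdot) (span_dot_eq_top hdot).ge, fun x => by
    rw [Module.Basis.mk_apply, sigWord_eq]⟩

theorem idem_mul_sigWord_ne_zero (i : Seq Γ ν m) {l : List (Idx m)} {x : W m}
    (h : IsReduced l x) : idem K i * sigWord Γ ν K l ≠ 0 := by
  intro h0
  rw [sigWord_eq] at h0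
  set Φ := polyFrame m K
  have hc : ∀ a, ∑ v, Φ.coeff Γ ν l v i * Φ.act v a = 0 := by
    intro a
    have h1 := congrArg (fun r => Φ.rep Γ ν r (fun _ => a) i) h0
    simpa [Module.End.mul_apply, Frame.rep_idem, Frame.opIdem_apply,
      Frame.rep_sigProd_const] using h1
  exact Φ.coeff_wprod_ne_zero h.reduced i (congrFun (Φ.eq_zero_of_sum_act hc) _)

end Basis

/-! ### The anti-involution, the basis of the right module and the ranks -/

section AntiInvolution

open MulOpposite

variable {I : Type u} {H : Type v} {Γ : InvQuiver I H} {ν : I →₀ ℕ} {m : ℕ}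
variable {K : Type w} [Field K]

theorem Q_op {A : Type*} [Ring A] (i j : I) (a b : A) :
    Γ.Q i j (op a) (op b) = op (Γ.Q i j a b) := by
  unfold InvQuiver.Q
  split_ifs
  · rfl
  · rw [op_mul, op_pow, op_pow, op_neg, op_one, op_sub]
    exact ((Commute.neg_one_left _).pow_left _).eq

theorem QQuot_op {A : Type*} [Ring A] (i j : I) {a b c : A} (hab : Commute a b)
    (hac : Commute a c) (hbc : Commute b c) :
    Γ.QQuot i j (op a) (op b) (op c) = op (Γ.QQuot i j a b c) := by
  unfold InvQuiver.QQuot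
  split_ifs
  · rfl
  · have h : Commute (a - b) (a - c) :=
      ((Commute.refl a).sub_left hab.symm).sub_right (hac.sub_left hbc)
    rw [op_mul, op_pow, op_neg, op_neg, op_one, Finset.op_sum,
      ((Commute.neg_one_left _).pow_left _).eq]
    refine congrArg (fun x => -x * _) (Finset.sum_congr rfl fun p _ => ?_)
    rw [(h.pow_pow _ _).eq, op_mul, op_pow, op_pow, op_sub, op_sub]

/-- The slide relation read backwards, with the idempotent moved from the right to the left; it
serves the opposite algebra. -/
theorem mul_sub_eq_smul_of_slide {A : Type*} [Ring A] [Algebra K A] {e e' x x' σ : A} {c : K}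
    (h₁ : x * e = e * x) (h₂ : e * σ = σ * e') (h₃ : x' * e' = e' * x')
    (h₄ : (σ * x' - x * σ) * e' = -c • e') : e * (x * σ - σ * x') = c • e' := by
  have h₅ : e * (x * σ - σ * x') = -((σ * x' - x * σ) * e') := by
    rw [mul_sub, ← mul_assoc, ← h₁, mul_assoc, h₂, ← mul_assoc e, h₂, mul_assoc σ, ← h₃, sub_mul]
    simp only [mul_assoc, neg_sub]
  rw [h₅, h₄, neg_smul, neg_neg]

theorem slideConst_s (k : Idx m) (l : Pos m) (i : Seq Γ ν m) :
    slideConst K k ((s k).1 l) i = -slideConst K k l i := by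
  have h1 := pos_ne_nxt k
  have h2 := pos_ne_flip_nxt k
  have h3 := flip_ne k.pos
  have h4 := flip_ne (nxt k)
  have h5 : nxt k ≠ flip m k.pos := fun h => h2 (by rw [h, flip_flip])
  have h6 : flip m k.pos ≠ flip m (nxt k) := fun h => h1 ((flip m).injective h)
  unfold slideConst
  by_cases h : i k.pos = i (nxt k)
  · rw [if_pos h, if_pos h]
    by_cases ha : l = k.pos
    · subst ha
      simp [h1.symm, h4.symm]
    by_cases hb : l = nxt k
    · subst hb
      simp [h1.symm, h4.symm]
    by_cases hc : l = flip m k.pos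
    · subst hc
      rw [W.apply_flip, s_pos]
      simp [h6, h3, h5.symm]
    by_cases hd : l = flip m (nxt k)
    · subst hd
      rw [W.apply_flip, s_nxt]
      simp [h6, h3, h5.symm]
    rw [s_apply_of_ne k ha hb hc hd]
    simp [ha, hb, hc, hd]
  · rw [if_neg h, if_neg h, neg_zero]

theorem idem_mul_sig (k : Idx m) (i : Seq Γ ν m) :
    idem K i * sig Γ ν K k = sig Γ ν K k * idem K (i.act (s k)) := by
  rw [(satisfies Γ ν m K).sig_idem, Seq.act_s_act_s]

theorem idem_mul_of_mem_F (i : Seq Γ ν m) {f : R Γ ν m K} (hf : f ∈ F Γ ν m K) :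
    idem K i * f = f * idem K i := F.mul_comm (idem_mem_F i) hf

variable (Γ ν m K) in
-- The relations are symmetric under reversal: squares and braid differences lie in the commutative
-- algebra `F`, so the idempotent may stand on either side. The reversed slide at `l` is the slide
-- at `s_k(l)`, where the sign of `slideConst` changes.
theorem satisfies_op : Satisfies Γ ν K (fun i => op (idem (m := m) K i))
    (fun l => op (kap Γ ν K l)) (fun k => op (sig Γ ν K k)) where
  sum_idem := by rw [← Finset.op_sum, (satisfies Γ ν m K).sum_idem, op_one]
  idem_self i := by rw [← op_mul, (satisfies Γ ν m K).idem_self]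
  idem_ne i j h := by rw [← op_mul, (satisfies Γ ν m K).idem_ne j i h.symm, op_zero]
  sig_idem k i := by rw [← op_mul, ← op_mul, idem_mul_sig]
  kap_idem l i := by rw [← op_mul, ← op_mul, (satisfies Γ ν m K).kap_idem]
  kap_flip l := by rw [(satisfies Γ ν m K).kap_flip, op_neg]
  kap_comm l l' := by rw [← op_mul, ← op_mul, (satisfies Γ ν m K).kap_comm]
  sig_sq k i := by
    rw [← op_mul, ← op_mul, Q_op, ← op_mul, idem_mul_of_mem_F i (sig_sq_mem_F k),
      (satisfies Γ ν m K).sig_sq, ← idem_mul_of_mem_F i (Q_mem_F _ _ _ _)]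
  sig_comm k k' h := by rw [← op_mul, ← op_mul, (satisfies Γ ν m K).sig_comm k k' h]
  braid k k' h i := by
    have hc := fun l l' => (satisfies Γ ν m K).kap_comm l l'
    rw [← op_mul, ← op_mul, ← op_mul, ← op_mul, ← op_sub, ← op_mul, ← mul_assoc, ← mul_assoc,
      idem_mul_of_mem_F i (braid_mem_F h), (satisfies Γ ν m K).braid k k' h,
      QQuot_op _ _ (hc _ _) (hc _ _) (hc _ _)]
    split_ifs
    · rw [← op_mul, idem_mul_of_mem_F i (QQuot_mem_F _ _ _ _ _)]
    · rw [op_zero]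
  slide k l i := by
    have h := (satisfies Γ ν m K).slide k ((s k).1 l) (i.act (s k))
    have hc : slideConst K k l (i.act (s k)) = slideConst K k l i := by
      unfold slideConst
      rw [Seq.act_s_apply, Seq.act_s_apply, s_pos, s_nxt]
      simp only [eq_comm (a := i (nxt k))]
    have hK := (satisfies Γ ν m K).kap_idem
    rw [s_s_apply, slideConst_s, hc] at h
    rw [← op_mul, ← op_mul, ← op_sub, ← op_mul, ← op_smul,
      mul_sub_eq_smul_of_slide (hK _ _) (idem_mul_sig k i) (hK _ _) h]
    by_cases hi : i k.pos = i (nxt k)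
    · rw [Seq.act_s_eq_self hi]
    · rw [slideConst, if_neg hi, zero_smul, zero_smul]

variable (Γ ν m K) in
/-- The anti-involution that fixes the generators. -/
def anti : R Γ ν m K →ₐ[K] (R Γ ν m K)ᵐᵒᵖ := (satisfies_op Γ ν m K).lift

/-- The anti-involution, as a map to the algebra itself. -/
def rev (r : R Γ ν m K) : R Γ ν m K := unop (anti Γ ν m K r)

theorem rev_mul (a b : R Γ ν m K) : rev (a * b) = rev b * rev a := by
  rw [rev, map_mul, unop_mul]; rfl

theorem rev_add (a b : R Γ ν m K) : rev (a + b) = rev a + rev b := by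
  rw [rev, map_add, unop_add]; rfl

theorem rev_zero : rev (0 : R Γ ν m K) = 0 := by
  rw [rev, map_zero, unop_zero]

theorem rev_sum {ι : Type*} (t : Finset ι) (f : ι → R Γ ν m K) :
    rev (∑ x ∈ t, f x) = ∑ x ∈ t, rev (f x) := by
  rw [rev, map_sum, Finset.unop_sum]; rfl

theorem rev_algebraMap (c : K) : rev (algebraMap K (R Γ ν m K) c) = algebraMap K _ c := by
  rw [rev, AlgHom.commutes]; rfl

theorem rev_idem (i : Seq Γ ν m) : rev (idem K i) = idem K i := by
  rw [rev, anti, Satisfies.lift_idem, unop_op]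

theorem rev_kap (l : Pos m) : rev (kap Γ ν K l) = kap Γ ν K l := by
  rw [rev, anti, Satisfies.lift_kap, unop_op]

theorem rev_sig (k : Idx m) : rev (sig Γ ν K k) = sig Γ ν K k := by
  rw [rev, anti, Satisfies.lift_sig, unop_op]

theorem rev_rev (r : R Γ ν m K) : rev (rev r) = r := by
  induction r using R.induction with
  | algebraMap c => rw [rev_algebraMap, rev_algebraMap]
  | idem i => rw [rev_idem, rev_idem]
  | kap l => rw [rev_kap, rev_kap]
  | sig k => rw [rev_sig, rev_sig]
  | mul a b ha hb => rw [rev_mul, rev_mul, ha, hb]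
  | add a b ha hb => rw [rev_add, rev_add, ha, hb]

theorem rev_of_mem_F {f : R Γ ν m K} (hf : f ∈ F Γ ν m K) : rev f = f := by
  induction hf using F.induction with
  | algebraMap c => exact rev_algebraMap c
  | idem i => exact rev_idem i
  | kap l => exact rev_kap l
  | mul a b ha hb h h' => rw [rev_mul, h, h', F.mul_comm hb ha]
  | add a b _ _ h h' => rw [rev_add, h, h']

theorem rev_sigProd (l : List (Idx m)) : rev (sigProd Γ ν K l) = sigProd Γ ν K l.reverse := by
  induction l with
  | nil =>
    have := rev_algebraMap (Γ := Γ) (ν := ν) (m := m) (1 : K)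
    rw [map_one] at this
    simpa [sigProd] using this
  | cons k l ih =>
    rw [sigProd_cons, rev_mul, ih, rev_sig]
    simp [sigProd]

theorem op_smul_eq (f : (F Γ ν m K).op) (r : R Γ ν m K) : f • r = r * unop f.1 := rfl

variable [CharZero K]

/-- The basis of the right module given by a choice of reduced words. -/
theorem exists_right_basis {dot : WD m → List (Idx m)} (hdot : ∀ x, IsReduced (dot x) x) :
    ∃ b : Module.Basis (WD m) (F Γ ν m K).op (R Γ ν m K), ∀ x, b x = sigWord Γ ν K (dot x) := by
  -- The anti-involution turns a word for `x` into one for `x⁻¹`, so the left theorem is applied to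
  -- the reversed words of the inverses.
  have hred : ∀ x : WD m, IsReduced (dot x⁻¹).reverse x := by
    intro x
    have h := (hdot x⁻¹).reduced.reverse
    have hw : wprod (dot x⁻¹).reverse = x := by
      rw [wprod_reverse, wprod, (hdot x⁻¹).1]
      simp
    rw [Reduced, hw] at h
    exact h
  have hrev : ∀ x, rev (sigProd Γ ν K (dot x)) = sigProd Γ ν K (dot (x⁻¹)⁻¹).reverse := by
    intro x; rw [rev_sigProd, inv_inv]
  have hrev' : ∀ x, rev (sigProd Γ ν K (dot x⁻¹).reverse) = sigProd Γ ν K (dot x⁻¹) := by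
    intro x; rw [rev_sigProd, List.reverse_reverse]
  have hli : LinearIndependent (F Γ ν m K).op fun x => sigProd Γ ν K (dot x) := by
    refine (Fintype.linearIndependent_iff (R := (F Γ ν m K).op) (M := R Γ ν m K)
      (ι := WD m)).2 fun g hg x => ?_
    have h1 := Fintype.linearIndependent_iff.1 (linearIndependent_dot (Γ := Γ) (ν := ν) (K := K) hred)
      (fun x => ⟨unop (g x⁻¹).1, (g x⁻¹).2⟩) ?_ x⁻¹
    · rw [inv_inv] at h1
      apply Subtype.ext
      exact unop_injective (congrArg Subtype.val h1)
    · have h2 := congrArg rev hg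
      rw [rev_sum, rev_zero] at h2
      rw [← h2, ← Equiv.sum_comp (Equiv.inv (WD m))]
      refine Finset.sum_congr rfl fun y _ => ?_
      rw [op_smul_eq, rev_mul, rev_of_mem_F (g _).2, hrev, Subalgebra.smul_def, smul_eq_mul]
      simp
  have hspan : ⊤ ≤ Submodule.span (F Γ ν m K).op (Set.range fun x => sigProd Γ ν K (dot x)) := by
    intro r _
    have h1 : rev r ∈ Submodule.span (F Γ ν m K)
        (Set.range fun x : WD m => sigProd Γ ν K (dot x⁻¹).reverse) := by
      rw [span_dot_eq_top hred]; trivial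
    rw [← rev_rev r]
    generalize rev r = t at h1
    induction h1 using Submodule.span_induction with
    | mem t ht =>
      obtain ⟨x, rfl⟩ := ht
      simp only [hrev']
      exact Submodule.subset_span ⟨x⁻¹, rfl⟩
    | zero => rw [rev_zero]; exact zero_mem _
    | add a b _ _ ha hb => rw [rev_add]; exact add_mem ha hb
    | smul f t _ ht =>
      rw [Subalgebra.smul_def, smul_eq_mul, rev_mul, rev_of_mem_F f.2]
      exact Submodule.smul_mem _ (⟨op f.1, f.2⟩ : (F Γ ν m K).op) ht
  exact ⟨.mk hli hspan, fun x => by rw [Module.Basis.mk_apply, sigWord_eq]⟩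

instance : CommRing (F Γ ν m K).op :=
  { (inferInstance : Ring (F Γ ν m K).op) with
    mul_comm := fun f g => Subtype.ext (unop_injective (F.mul_comm g.2 f.2)) }

section Rank

theorem idem_ne_zero (i : Seq Γ ν m) : idem K i ≠ 0 := by
  have := idem_mul_sigWord_ne_zero (K := K) i (l := []) (x := 1) ⟨rfl, fun _ _ => Nat.zero_le _⟩
  exact left_ne_zero_of_mul this

variable [Nonempty (Seq Γ ν m)]

instance : Nontrivial (R Γ ν m K) :=
  ⟨idem K (Classical.arbitrary _), 0, idem_ne_zero _⟩

theorem finrank_left (hm : m ≠ 0) :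
    Module.finrank (F Γ ν m K) (R Γ ν m K) = 2 ^ (m - 1) * m.factorial := by
  choose dot hdot using fun x : WD m => exists_isReduced x.2
  obtain ⟨b, _⟩ := exists_left_basis (Γ := Γ) (ν := ν) (K := K) hdot
  have : StrongRankCondition (F Γ ν m K) := commRing_strongRankCondition _
  rw [Module.finrank_eq_nat_card_basis b, card_WD hm]

theorem finrank_right (hm : m ≠ 0) :
    Module.finrank (F Γ ν m K).op (R Γ ν m K) = 2 ^ (m - 1) * m.factorial := by
  choose dot hdot using fun x : WD m => exists_isReduced x.2
  obtain ⟨b, _⟩ := exists_right_basis (Γ := Γ) (ν := ν) (K := K) hdot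
  have : StrongRankCondition (F Γ ν m K).op := commRing_strongRankCondition _
  rw [Module.finrank_eq_nat_card_basis b, card_WD hm]

end Rank

end AntiInvolution

/-! ### The grading, and the degree of a word -/

section Grading

variable {I : Type u} {H : Type v} {Γ : InvQuiver I H} {ν : I →₀ ℕ} {m : ℕ}
variable {K : Type w} [Field K]

variable (Γ ν m K) in
/-- The algebra of Laurent polynomials, in which degrees are recorded. -/
abbrev Laurent := AddMonoidAlgebra (R Γ ν m K) ℤ

/-- The element `r` in degree `d`. -/
def inDeg (d : ℤ) : R Γ ν m K →+ Laurent Γ ν m K := AddMonoidAlgebra.singleAddHom d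

theorem inDeg_mul (d d' : ℤ) (r r' : R Γ ν m K) :
    inDeg d r * inDeg d' r' = inDeg (d + d') (r * r') :=
  AddMonoidAlgebra.single_mul_single ..

theorem inDeg_pow (d : ℤ) (r : R Γ ν m K) (n : ℕ) : inDeg d r ^ n = inDeg (n * d) (r ^ n) := by
  rw [← nsmul_eq_mul]
  exact AddMonoidAlgebra.single_pow ..

theorem inDeg_zero_one : inDeg 0 (1 : R Γ ν m K) = 1 := rfl

theorem inDeg_smul (d : ℤ) (c : K) (r : R Γ ν m K) : inDeg d (c • r) = c • inDeg d r :=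
  (AddMonoidAlgebra.smul_single c d r).symm

theorem inDeg_apply_self (d : ℤ) (r : R Γ ν m K) : (inDeg d r : Laurent Γ ν m K).coeff d = r := by
  change (AddMonoidAlgebra.single d r).coeff d = r
  rw [AddMonoidAlgebra.coeff_single, Finsupp.single_eq_same]

theorem inDeg_apply_of_ne {d d' : ℤ} (h : d ≠ d') (r : R Γ ν m K) :
    (inDeg d r : Laurent Γ ν m K).coeff d' = 0 := by
  change (AddMonoidAlgebra.single d r).coeff d' = 0
  rw [AddMonoidAlgebra.coeff_single, Finsupp.single_eq_of_ne (Ne.symm h)]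

variable (Γ) in
/-- The degree of `σ_k 1_i`. -/
abbrev sigDeg (k : Idx m) (i : Seq Γ ν m) : ℤ := -Γ.pairing (i k.pos) (i (nxt k))

variable (Γ ν K) in
/-- The element `σ_k`, with its degrees recorded. -/
def laurentSig (k : Idx m) : Laurent Γ ν m K :=
  ∑ i, inDeg (sigDeg Γ k i) (sig Γ ν K k * idem K i)

theorem laurentSig_mul (k : Idx m) {i : Seq Γ ν m} {y : R Γ ν m K} (hy : idem K i * y = y)
    (n : ℤ) : laurentSig Γ ν K k * inDeg n y = inDeg (sigDeg Γ k i + n) (sig Γ ν K k * y) := by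
  rw [laurentSig, Finset.sum_mul, Finset.sum_eq_single i]
  · rw [inDeg_mul, mul_assoc, hy]
  · intro j _ hj
    rw [inDeg_mul, mul_assoc, ← hy, ← mul_assoc (idem K j), (satisfies Γ ν m K).idem_ne j i hj,
      zero_mul, mul_zero, map_zero]
  · simp

theorem idem_act_mul_sig_mul (k : Idx m) {i : Seq Γ ν m} {y : R Γ ν m K} (hy : idem K i * y = y) :
    idem K (i.act (s k)) * (sig Γ ν K k * y) = sig Γ ν K k * y := by
  rw [← mul_assoc, ← (satisfies Γ ν m K).sig_idem, mul_assoc, hy]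

theorem inDeg_sub (d : ℤ) (r r' : R Γ ν m K) : inDeg d (r - r') = inDeg d r - inDeg d r' :=
  map_sub (inDeg d) r r'

theorem inDeg_neg (d : ℤ) (r : R Γ ν m K) : inDeg d (-r) = -inDeg d r :=
  map_neg (inDeg d) r

theorem neg_one_pow_mul_inDeg (n : ℕ) (d : ℤ) (r : R Γ ν m K) :
    (-1) ^ n * inDeg d r = inDeg d ((-1) ^ n * r) := by
  rw [← inDeg_zero_one, ← inDeg_neg, inDeg_pow, inDeg_mul, mul_zero, zero_add]

theorem inDeg_Q (i j : I) (a b : R Γ ν m K) :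
    Γ.Q i j (inDeg 2 a) (inDeg 2 b) =
      inDeg (((Γ.numArrows i j + Γ.numArrows j i : ℕ) : ℤ) * 2) (Γ.Q i j a b) := by
  unfold InvQuiver.Q
  split_ifs
  · rw [map_zero]
  · rw [← inDeg_sub, inDeg_pow, neg_one_pow_mul_inDeg]

theorem inDeg_QQuot (i j : I) (a b c : R Γ ν m K) :
    Γ.QQuot i j (inDeg 2 a) (inDeg 2 b) (inDeg 2 c) =
      inDeg (((Γ.numArrows i j + Γ.numArrows j i : ℕ) : ℤ) * 2 - 2) (Γ.QQuot i j a b c) := by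
  unfold InvQuiver.QQuot
  split_ifs
  · rw [map_zero]
  · rw [← neg_one_pow_mul_inDeg, inDeg_neg, map_sum]
    refine congrArg (fun x => _ * -x) (Finset.sum_congr rfl fun p hp => ?_)
    rw [← inDeg_sub, ← inDeg_sub, inDeg_pow, inDeg_pow, inDeg_mul]
    congr 1
    have := Finset.mem_range.1 hp
    congr 1
    omega

theorem sigDeg_act {k k' : Idx m} {i : Seq Γ ν m}
    (h : SameRoot ((s k').1 k.pos) ((s k').1 (nxt k)) k.pos (nxt k)) :
    sigDeg Γ k (i.act (s k')) = sigDeg Γ k i := by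
  rw [sigDeg, Seq.act_s_apply, Seq.act_s_apply]
  rcases h with ⟨h1, h2⟩ | ⟨h1, h2⟩
  · rw [h1, h2]
  · rw [h1, h2, Seq.apply_flip, Seq.apply_flip, Γ.pairing_θ]

theorem sigDeg_act_self (k : Idx m) (i : Seq Γ ν m) :
    sigDeg Γ k (i.act (s k)) = sigDeg Γ k i := by
  rw [sigDeg, Seq.act_s_apply, Seq.act_s_apply, s_pos, s_nxt, Γ.pairing_comm]

theorem sigDeg_of_ne {k : Idx m} {i : Seq Γ ν m} (h : i k.pos ≠ i (nxt k)) :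
    sigDeg Γ k i = ((Γ.numArrows (i k.pos) (i (nxt k)) + Γ.numArrows (i (nxt k)) (i k.pos) : ℕ) : ℤ)
      := by
  rw [sigDeg, InvQuiver.pairing, if_neg h]
  push_cast
  ring

/-- Both sides are minus the sum of the pairings over the three pairs of vertices at `k.pos`,
`k'.pos`, `k'.succ`. -/
theorem sigDeg_braid {k k' : Idx m} (h : k'.pos = nxt k) (i : Seq Γ ν m) :
    sigDeg Γ k' ((i.act (s k')).act (s k)) + (sigDeg Γ k (i.act (s k')) + sigDeg Γ k' i) =
      sigDeg Γ k ((i.act (s k)).act (s k')) + (sigDeg Γ k' (i.act (s k)) + sigDeg Γ k i) := by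
  obtain ⟨h1, h2, h3, h4, h5, h6⟩ := braid_values h
  simp only [sigDeg, Seq.act_s_apply, nxt_eq_succ h, ← h, h1, h2, h3, h4, h5, h6]
  ring

theorem laurent_sub_mul (a b c : Laurent Γ ν m K) : (a - b) * c = a * c - b * c := sub_mul a b c

theorem laurent_ext {a b : Laurent Γ ν m K}
    (h : ∀ i, a * inDeg 0 (idem K i) = b * inDeg 0 (idem K i)) : a = b := by
  have h1 : ∑ i, (inDeg 0 (idem K i) : Laurent Γ ν m K) = 1 := by
    rw [← map_sum, (satisfies Γ ν m K).sum_idem, inDeg_zero_one]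
  rw [← mul_one a, ← mul_one b, ← h1, Finset.mul_sum, Finset.mul_sum]
  exact Finset.sum_congr rfl fun i _ => h i

variable (Γ ν m K) in
theorem satisfies_laurent : Satisfies Γ ν K (fun i : Seq Γ ν m => inDeg 0 (idem K i))
    (fun l => inDeg 2 (kap Γ ν K l)) (laurentSig Γ ν K) where
  sum_idem := by rw [← map_sum, (satisfies Γ ν m K).sum_idem, inDeg_zero_one]
  idem_self i := by rw [inDeg_mul, (satisfies Γ ν m K).idem_self, add_zero]
  idem_ne i j h := by rw [inDeg_mul, (satisfies Γ ν m K).idem_ne i j h, map_zero]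
  sig_idem k i := by
    rw [laurentSig_mul k ((satisfies Γ ν m K).idem_self i), laurentSig, Finset.mul_sum,
      Finset.sum_eq_single i]
    · rw [inDeg_mul, idem_act_mul_sig_mul k ((satisfies Γ ν m K).idem_self i), add_comm]
    · intro j _ hj
      rw [inDeg_mul, (satisfies Γ ν m K).sig_idem, ← mul_assoc, (satisfies Γ ν m K).idem_ne,
        zero_mul, map_zero]
      intro h
      apply hj
      rw [← Seq.act_s_act_s k j, ← h, Seq.act_s_act_s]
    · simp
  kap_idem l i := by
    rw [inDeg_mul, inDeg_mul, (satisfies Γ ν m K).kap_idem, add_comm]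
  kap_flip l := by rw [(satisfies Γ ν m K).kap_flip, inDeg_neg]
  kap_comm l l' := by rw [inDeg_mul, inDeg_mul, (satisfies Γ ν m K).kap_comm]
  sig_sq k i := by
    have h0 := (satisfies Γ ν m K).idem_self i
    rw [mul_assoc, laurentSig_mul k h0, laurentSig_mul k (idem_act_mul_sig_mul k h0), inDeg_Q,
      inDeg_mul, sigDeg_act_self, ← mul_assoc, (satisfies Γ ν m K).sig_sq]
    by_cases h : i k.pos = i (nxt k)
    · simp [InvQuiver.Q, h]
    · rw [sigDeg_of_ne h]
      congr 2
      ring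
  sig_comm k k' h := by
    apply laurent_ext
    intro i
    have h0 := (satisfies Γ ν m K).idem_self i
    rw [mul_assoc, mul_assoc, laurentSig_mul k h0, laurentSig_mul k' h0,
      laurentSig_mul k (idem_act_mul_sig_mul k' h0), laurentSig_mul k' (idem_act_mul_sig_mul k h0),
      sigDeg_act h.sameRoot, sigDeg_act h.sameRoot', ← mul_assoc, ← mul_assoc,
      (satisfies Γ ν m K).sig_comm k k' h, add_left_comm]
  braid k k' h i := by
    have h0 := (satisfies Γ ν m K).idem_self i
    have hb := (satisfies Γ ν m K).braid k k' h i
    rw [sub_mul] at hb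
    simp only [mul_assoc] at hb
    refine (laurent_sub_mul _ _ _).trans ?_
    simp only [mul_assoc]
    rw [laurentSig_mul k h0, laurentSig_mul k' h0,
      laurentSig_mul k (idem_act_mul_sig_mul k' h0), laurentSig_mul k' (idem_act_mul_sig_mul k h0),
      laurentSig_mul k' (idem_act_mul_sig_mul k (idem_act_mul_sig_mul k' h0)),
      laurentSig_mul k (idem_act_mul_sig_mul k' (idem_act_mul_sig_mul k h0)),
      ← add_assoc (sigDeg Γ k _), ← add_assoc (sigDeg Γ k' (i.act (s k))), add_zero, add_zero,
      ← sigDeg_braid h, ← inDeg_sub, hb, inDeg_QQuot, inDeg_mul]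
    split_ifs with hi
    · by_cases h' : i k.pos = i (nxt k)
      · simp [InvQuiver.QQuot, h']
      · congr 2
        have h1 := sigDeg_of_ne (Γ := Γ) h'
        have h2 : sigDeg Γ k' i = sigDeg Γ k i := by
          rw [sigDeg, nxt_eq_succ h, ← hi, h, Γ.pairing_comm]
        have h3 : sigDeg Γ k (i.act (s k')) = -2 := by
          obtain ⟨-, -, -, h4, h5, -⟩ := braid_values h
          rw [sigDeg, Seq.act_s_apply, Seq.act_s_apply, ← h, h4, h5, hi, InvQuiver.pairing,
            if_pos rfl]
        have h4 : sigDeg Γ k' ((i.act (s k')).act (s k)) = sigDeg Γ k i := by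
          obtain ⟨-, h4, h5, h6, -, h8⟩ := braid_values h
          rw [sigDeg, Seq.act_s_apply, Seq.act_s_apply, Seq.act_s_apply, Seq.act_s_apply,
            nxt_eq_succ h, h4, h5, h6, h8, h]
        omega
    · rw [map_zero]
  slide k l i := by
    have h0 := (satisfies Γ ν m K).idem_self i
    have hk : idem K i * (kap Γ ν K l * idem K i) = kap Γ ν K l * idem K i := by
      rw [← mul_assoc, ← (satisfies Γ ν m K).kap_idem, mul_assoc, h0]
    have hs := (satisfies Γ ν m K).slide k l i
    rw [sub_mul, mul_assoc, mul_assoc] at hs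
    refine (laurent_sub_mul _ _ _).trans ?_
    rw [mul_assoc, mul_assoc, inDeg_mul, laurentSig_mul k hk, laurentSig_mul k h0,
      inDeg_mul, add_zero, add_zero, add_comm 2, ← inDeg_sub, hs, inDeg_smul]
    by_cases h : i k.pos = i (nxt k)
    · congr 2
      simp [sigDeg, InvQuiver.pairing, h]
    · simp [slideConst, h]

variable (Γ ν m K) in
/-- The homomorphism that records degrees. -/
def degHom : R Γ ν m K →ₐ[K] Laurent Γ ν m K := (satisfies_laurent Γ ν m K).lift

theorem degHom_elem (g : HGen Γ ν m) : degHom Γ ν m K (g.elem K) = inDeg g.deg (g.elem K) := by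
  cases g with
  | idem i => exact Satisfies.lift_idem _ _
  | kap l i =>
    rw [HGen.elem, map_mul, degHom, Satisfies.lift_kap, Satisfies.lift_idem, inDeg_mul, add_zero]
    rfl
  | sig k i =>
    rw [HGen.elem, map_mul, degHom, Satisfies.lift_sig, Satisfies.lift_idem,
      laurentSig_mul k ((satisfies Γ ν m K).idem_self i), add_zero]
    rfl

theorem degHom_of_mem {d : ℤ} {r : R Γ ν m K} (hr : r ∈ grading Γ ν m K d) :
    degHom Γ ν m K r = inDeg d r := by
  induction hr using Submodule.span_induction with
  | mem r hr =>
    obtain ⟨l, rfl, rfl⟩ := hr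
    induction l with
    | nil => rw [List.map_nil, List.prod_nil, map_one]; rfl
    | cons g l ih =>
      rw [List.map_cons, List.prod_cons, map_mul, ih, degHom_elem, inDeg_mul, List.map_cons,
        List.sum_cons]
  | zero => rw [map_zero, map_zero]
  | add a b _ _ ha hb => rw [map_add, map_add, ha, hb]
  | smul c r _ h => rw [map_smul, h, inDeg_smul]

instance grading_gradedMonoid : SetLike.GradedMonoid (grading Γ ν m K) where
  one_mem := Submodule.subset_span ⟨[], rfl, rfl⟩
  mul_mem {d d'} a b ha hb := by
    have h := Submodule.mul_mem_mul ha hb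
    rw [grading, grading, Submodule.span_mul_span] at h
    refine Submodule.span_mono ?_ h
    rintro _ ⟨_, ⟨l, rfl, rfl⟩, _, ⟨l', rfl, rfl⟩, rfl⟩
    exact ⟨l ++ l', by simp, by simp⟩

theorem elem_mem_grading (g : HGen Γ ν m) : g.elem K ∈ grading Γ ν m K g.deg :=
  Submodule.subset_span ⟨[g], by simp, by simp⟩

theorem isInternal_grading : DirectSum.IsInternal (grading Γ ν m K) := by
  constructor
  · intro x y hxy
    have h1 : ∀ x : DirectSum ℤ fun d => grading Γ ν m K d, ∀ d,
        (degHom Γ ν m K (DirectSum.coeAddMonoidHom (grading Γ ν m K) x)).coeff d = x d := by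
      intro x d
      induction x using DirectSum.induction_on with
      | zero => simp
      | of d' r =>
        rw [DirectSum.coeAddMonoidHom_of, degHom_of_mem r.2]
        by_cases h : d' = d
        · subst h
          rw [inDeg_apply_self, DirectSum.of_eq_same]
        · rw [DirectSum.of_eq_of_ne _ _ _ (Ne.symm h)]
          exact inDeg_apply_of_ne h _
      | add a b ha hb => rw [map_add, map_add, AddMonoidAlgebra.coeff_add, Finsupp.add_apply, ha, hb,
          DirectSum.add_apply]; rfl
    refine DFinsupp.ext fun d => Subtype.ext ?_
    rw [← h1, hxy, h1]
  · have hs : ∀ r, ∃ x, DirectSum.coeAlgHom (grading Γ ν m K) x = r := by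
      have he : ∀ g : HGen Γ ν m, ∃ x, DirectSum.coeAlgHom (grading Γ ν m K) x = g.elem K :=
        fun g => ⟨_, DirectSum.coeAlgHom_of _ _ ⟨_, elem_mem_grading g⟩⟩
      have hsum : ∀ f : Seq Γ ν m → R Γ ν m K,
          (∀ i, ∃ x, DirectSum.coeAlgHom (grading Γ ν m K) x = f i) →
          ∃ x, DirectSum.coeAlgHom (grading Γ ν m K) x = ∑ i, f i := by
        intro f hf
        choose x hx using hf
        exact ⟨∑ i, x i, by rw [map_sum]; exact Finset.sum_congr rfl fun i _ => hx i⟩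
      intro r
      induction r using R.induction with
      | algebraMap c => exact ⟨algebraMap K _ c, AlgHom.commutes _ c⟩
      | idem i => exact he (.idem i)
      | kap l =>
        rw [mul_eq_sum_idem (kap Γ ν K l)]
        exact hsum _ fun i => he (.kap l i)
      | sig k =>
        rw [mul_eq_sum_idem (sig Γ ν K k)]
        exact hsum _ fun i => he (.sig k i)
      | mul a b ha hb =>
        obtain ⟨x, rfl⟩ := ha
        obtain ⟨y, rfl⟩ := hb
        exact ⟨x * y, map_mul _ _ _⟩
      | add a b ha hb =>
        obtain ⟨x, rfl⟩ := ha
        obtain ⟨y, rfl⟩ := hb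
        exact ⟨x + y, map_add _ _ _⟩
    exact hs

theorem nonempty_gradedAlgebra : Nonempty (GradedAlgebra (grading Γ ν m K)) :=
  ⟨{ grading_gradedMonoid, isInternal_grading.chooseDecomposition with }⟩

/-- The degree of `1_i` times the product of the `σ_k` over a word. -/
def wordDeg : List (Idx m) → Seq Γ ν m → ℤ
  | [], _ => 0
  | k :: l, i => sigDeg Γ k (i.act (s k)) + wordDeg l (i.act (s k))

theorem idem_mul_sigProd_mem (l : List (Idx m)) (i : Seq Γ ν m) :
    idem K i * sigProd Γ ν K l ∈ grading Γ ν m K (wordDeg l i) := by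
  induction l generalizing i with
  | nil =>
    have h := elem_mem_grading (K := K) (HGen.idem i)
    rw [sigProd, List.map_nil, List.prod_nil, mul_one]
    exact h
  | cons k l ih =>
    have h := SetLike.mul_mem_graded (elem_mem_grading (K := K) (HGen.sig k (i.act (s k))))
      (ih (i.act (s k)))
    rw [HGen.elem, mul_assoc, ← mul_assoc (idem K _), (satisfies Γ ν m K).idem_self, ← mul_assoc,
      ← idem_mul_sig, mul_assoc, ← sigProd_cons] at h
    exact h

theorem BraidEq.wordDeg_eq {l l' : List (Idx m)} (h : BraidEq l l') (i : Seq Γ ν m) :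
    wordDeg l i = wordDeg l' i := by
  induction h generalizing i with
  | refl => rfl
  | symm _ ih => exact (ih i).symm
  | trans _ _ ih ih' => exact (ih i).trans (ih' i)
  | cons k _ ih => rw [wordDeg, wordDeg, ih]
  | comm k k' h l =>
    simp only [wordDeg]
    rw [sigDeg_act_self, sigDeg_act_self, sigDeg_act_self, sigDeg_act_self, sigDeg_act h.sameRoot,
      sigDeg_act h.sameRoot', ← Seq.act_mul, ← Seq.act_mul, h.comm]
    ring
  | braid k k' h l =>
    have h1 := sigDeg_braid h i
    simp only [wordDeg, sigDeg_act_self]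
    have h2 : ((i.act (s k')).act (s k)).act (s k') = ((i.act (s k)).act (s k')).act (s k) := by
      simp only [← Seq.act_mul, ← mul_assoc, braid_mul h]
    rw [h2]
    linarith

end Grading

section Existence

variable {I : Type u} {H : Type v} (Γ : InvQuiver I H)

theorem exists_half_of_symmetric (m : ℕ) : ∀ ν : I →₀ ℕ, (∀ i, ν (Γ.θ i) = ν i) →
    ∑ i ∈ ν.support, ν i = 2 * m → ∃ g : Fin m → I,
      ∑ l, (Finsupp.single (g l) 1 + Finsupp.single (Γ.θ (g l)) 1) = ν := by
  induction m with
  | zero =>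
    intro ν _ hν
    refine ⟨Fin.elim0, ?_⟩
    rw [mul_zero, Finset.sum_eq_zero_iff] at hν
    ext i
    by_cases hi : i ∈ ν.support
    · rw [hν i hi]; simp
    · rw [Finsupp.notMem_support_iff.1 hi]; simp
  | succ m ih =>
    intro ν hθ hν
    have hne : ∃ i, ν i ≠ 0 := by
      by_contra! h
      rw [Finset.sum_eq_zero fun i _ => h i] at hν
      omega
    obtain ⟨i, hi⟩ := hne
    set δ : I →₀ ℕ := Finsupp.single i 1 + Finsupp.single (Γ.θ i) 1 with hδ
    have hle : δ ≤ ν := by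
      intro j
      rw [hδ, Finsupp.add_apply, Finsupp.single_apply, Finsupp.single_apply]
      have h1 := Γ.θ_ne i
      have h2 := hθ i
      split_ifs with h3 h4 h4
      · exact absurd (h4.trans h3.symm) h1
      · subst h3; omega
      · subst h4; omega
      · exact Nat.zero_le _
    obtain ⟨ν', rfl⟩ := exists_add_of_le hle
    have hδθ : ∀ j, δ (Γ.θ j) = δ j := by
      intro j
      have h1 : i = Γ.θ j ↔ Γ.θ i = j := by
        constructor
        · rintro rfl; exact Γ.θ_invol j
        · rintro rfl; exact (Γ.θ_invol i).symm
      rw [hδ, Finsupp.add_apply, Finsupp.add_apply, Finsupp.single_apply, Finsupp.single_apply,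
        Finsupp.single_apply, Finsupp.single_apply, Γ.θ_injective.eq_iff, add_comm]
      simp only [h1]
    have hsum : ∀ μ : I →₀ ℕ, ∑ i ∈ μ.support, μ i = μ.sum fun _ n => n := fun _ => rfl
    rw [hsum, Finsupp.sum_add_index' (fun _ => rfl) (fun _ _ _ => rfl), hδ,
      Finsupp.sum_add_index' (fun _ => rfl) (fun _ _ _ => rfl), Finsupp.sum_single_index rfl,
      Finsupp.sum_single_index rfl] at hν
    obtain ⟨g, hg⟩ := ih ν' (fun j => by
      have := hθ j
      change δ _ + ν' _ = δ _ + ν' _ at this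
      rw [hδθ] at this
      omega) (by rw [hsum]; omega)
    refine ⟨Fin.cons i g, ?_⟩
    rw [Fin.sum_univ_succ]
    simp only [Fin.cons_zero, Fin.cons_succ]
    rw [hg]

/-- The positions, as two copies of `{1, …, m}`. -/
def posEquiv (m : ℕ) : Fin m ⊕ Fin m ≃ Pos m :=
  Equiv.ofBijective (Sum.elim Pos.ofFin fun l => flip m (Pos.ofFin l)) (by
    have hinj : ∀ a b : Fin m, (Pos.ofFin a).1 = (Pos.ofFin b).1 → a = b := by
      intro a b h
      simp only [Pos.ofFin] at h
      ext
      omega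
    have hpos : ∀ a : Fin m, 1 ≤ (Pos.ofFin a).1 := fun a => by simp [Pos.ofFin]
    constructor
    · rintro (a | a) (b | b) h
      · exact congrArg _ (hinj a b (congrArg Subtype.val h))
      · have h' := congrArg Subtype.val h
        simp only [Sum.elim_inl, Sum.elim_inr, flip_val] at h'
        have := hpos a
        have := hpos b
        omega
      · have h' := congrArg Subtype.val h
        simp only [Sum.elim_inl, Sum.elim_inr, flip_val] at h'
        have := hpos a
        have := hpos b
        omega
      · exact congrArg _ (hinj a b (congrArg Subtype.val ((flip m).injective h)))
    · intro l
      obtain ⟨i, rfl | rfl⟩ := exists_ofFin l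
      · exact ⟨.inl i, rfl⟩
      · exact ⟨.inr i, rfl⟩)

theorem nonempty_seq {ν : I →₀ ℕ} {m : ℕ} (hθ : ∀ i, ν (Γ.θ i) = ν i)
    (hm : ∑ i ∈ ν.support, ν i = 2 * m) : Nonempty (Seq Γ ν m) := by
  obtain ⟨g, hg⟩ := exists_half_of_symmetric Γ m ν hθ hm
  set f : Pos m → I := fun l => Sum.elim g (fun i => Γ.θ (g i)) ((posEquiv m).symm l) with hf
  have hl : ∀ i, f (Pos.ofFin i) = g i := fun i => by
    rw [hf]
    change Sum.elim g _ ((posEquiv m).symm (posEquiv m (.inl i))) = _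
    rw [Equiv.symm_apply_apply, Sum.elim_inl]
  have hr : ∀ i, f (flip m (Pos.ofFin i)) = Γ.θ (g i) := fun i => by
    rw [hf]
    change Sum.elim g _ ((posEquiv m).symm (posEquiv m (.inr i))) = _
    rw [Equiv.symm_apply_apply, Sum.elim_inr]
  refine ⟨⟨f, fun l => ?_, ?_⟩⟩
  · obtain ⟨i, rfl | rfl⟩ := exists_ofFin l
    · rw [hl, hr]
    · rw [flip_flip, hl, hr, Γ.θ_invol]
  · rw [← Equiv.sum_comp (posEquiv m), Fintype.sum_sum_type]
    change ∑ i, Finsupp.single (f (Pos.ofFin i)) 1 +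
      ∑ i, Finsupp.single (f (flip m (Pos.ofFin i))) 1 = ν
    simp only [hl, hr]
    rw [← Finset.sum_add_distrib, hg]

end Existence

end TypeD

end

theorem proposition1p4 {K : Type*} [Field K] [IsAlgClosed K] [CharZero K]
    {I H : Type*} (Γ : TypeD.InvQuiver I H)
    (ν : I →₀ ℕ) (hθ : ∀ i, ν (Γ.θ i) = ν i) (hν : ν ≠ 0)
    (m : ℕ) (hm : ∑ i ∈ ν.support, ν i = 2 * m) :
    -- the algebra is graded
    Nonempty (GradedAlgebra (TypeD.grading Γ ν m K)) ∧
    -- the subalgebra `F` is the direct sum of the polynomial algebras `K[ϰ_1, …, ϰ_m] 1_i`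
    (∃ e : (TypeD.Seq Γ ν m → MvPolynomial (Fin m) K) ≃ₐ[K] TypeD.F Γ ν m K,
      ∀ i, (e (Pi.single i 1) : TypeD.R Γ ν m K) = TypeD.idem K i ∧
        ∀ l, (e (Pi.single i (MvPolynomial.X l)) : TypeD.R Γ ν m K) =
          TypeD.kap Γ ν K (TypeD.Pos.ofFin l) * TypeD.idem K i) ∧
    -- for every choice of reduced decompositions, a basis of the left and of the right module
    (∀ dot : TypeD.WD m → List (TypeD.Idx m), (∀ x, TypeD.IsReduced (dot x) x) →
      (∃ b : Module.Basis (TypeD.WD m) (TypeD.F Γ ν m K) (TypeD.R Γ ν m K),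
        ∀ x, b x = TypeD.sigWord Γ ν K (dot x)) ∧
      (∃ b : Module.Basis (TypeD.WD m) (TypeD.F Γ ν m K).op (TypeD.R Γ ν m K),
        ∀ x, b x = TypeD.sigWord Γ ν K (dot x))) ∧
    -- the ranks
    Module.finrank (TypeD.F Γ ν m K) (TypeD.R Γ ν m K) = 2 ^ (m - 1) * m.factorial ∧
    Module.finrank (TypeD.F Γ ν m K).op (TypeD.R Γ ν m K) = 2 ^ (m - 1) * m.factorial ∧
    -- homogeneity of `1_i σ_ẇ`, in a degree which does not depend on the reduced decomposition
    (∀ (i : TypeD.Seq Γ ν m) (x : TypeD.WD m), ∃ d : ℤ,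
      ∀ l : List (TypeD.Idx m), TypeD.IsReduced l (x : TypeD.W m) →
        TypeD.idem K i * TypeD.sigWord Γ ν K l ≠ 0 ∧
        TypeD.idem K i * TypeD.sigWord Γ ν K l ∈ TypeD.grading Γ ν m K d) := by
  have hne := TypeD.nonempty_seq Γ hθ hm
  have hm0 : m ≠ 0 := by
    rintro rfl
    rw [mul_zero, Finset.sum_eq_zero_iff] at hm
    refine hν (Finsupp.ext fun i => ?_)
    by_contra hi
    exact hi (hm i (Finsupp.mem_support_iff.2 hi))
  refine ⟨TypeD.nonempty_gradedAlgebra, ⟨TypeD.polyEquiv Γ ν m K, fun i => ⟨?_, fun l => ?_⟩⟩,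
    fun dot hdot => ⟨TypeD.exists_left_basis hdot, TypeD.exists_right_basis hdot⟩,
    TypeD.finrank_left hm0, TypeD.finrank_right hm0, fun i x => ?_⟩
  · change (TypeD.polyHom Γ ν m K (Pi.single i 1) : TypeD.R Γ ν m K) = _
    rw [TypeD.polyHom_single, map_one, one_mul]
    rfl
  · change (TypeD.polyHom Γ ν m K (Pi.single i (MvPolynomial.X l)) : TypeD.R Γ ν m K) = _
    rw [TypeD.polyHom_single, ← TypeD.polyX_ofFin, MulMemClass.coe_mul, TypeD.evalKap_polyX]
    rfl
  · obtain ⟨l₀, h₀⟩ := TypeD.exists_isReduced x.2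
    refine ⟨TypeD.wordDeg l₀ i, fun l hl => ⟨TypeD.idem_mul_sigWord_ne_zero i hl, ?_⟩⟩
    rw [TypeD.sigWord_eq, (h₀.braidEq hl).wordDeg_eq i]
    exact TypeD.idem_mul_sigProd_mem l i
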